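/- Let $n,m\in\mathbb N$, let $x_1,\dots,x_m\in\mathbb R^2$ be distinct, $X=\{x_1,\dots,x_m\}$, and let $H$ be the minimal Schrödinger operator in $L^2(\mathbb R^2,\mathbb C^n)$, $$H=-\Delta\otimes I_n,\qquad \operatorname{dom}(H)=\{f\in W^2_2(\mathbb R^2,\mathbb C^n): f(x_j)=0,\ j=1,\dots,m\}.$$ Then $H$ is closed, densely defined and symmetric. Every $f\in\operatorname{dom}(H^*)$ has a representative that is continuous on $\mathbb R^2\setminus X$, and with this representative the limits $$\xi_j(f)=\lim_{x\to x_j}\frac{f(x)}{\ln|x-x_j|},\qquad \Gamma_0f=\{-2\pi\,\xi_j(f)\}_{j=1}^m,\qquad \Gamma_1f=\Big\{\lim_{x\to x_j}\big(f(x)-\ln|x-x_j|\,\xi_j(f)\big)\Big\}_{j=1}^m$$ exist and define a boundary triplet $\Pi=\{\mathcal H,\Gamma_0,\Gamma_1\}$ for $H^*$ with $\mathcal H=\bigoplus_{j=1}^m\mathbb C^n$; that is, $\Gamma_0,\Gamma_1:\operatorname{dom}(H^*)\to\mathcal H$ are linear, $(H^*f,g)-(f,H^*g)=(\Gamma_1f,\Gamma_0g)-(\Gamma_0f,\Gamma_1g)$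 for all $f,g\in\operatorname{dom}(H^*)$, and $f\mapsto(\Gamma_0f,\Gamma_1f)$ maps $\operatorname{dom}(H^*)$ onto $\mathcal H\oplus\mathcal H$. Put $H_0=H^*\upharpoonright\ker\Gamma_0$ and, for $z\in\rho(H_0)$, let $\gamma(z)=(\Gamma_0\upharpoonright\ker(H^*-z))^{-1}$ be the $\gamma$-field and $M(z)=\Gamma_1\gamma(z)$ the Weyl function of $\Pi$. Then every $z$ with $\operatorname{Im}z>0$ belongs to $\rho(H_0)$, and for such $z$: (i) $M(z)=\bigoplus_{s=1}^nM_s(z)$, where each $M_s(z)$ is the $m\times m$ matrix $$M_s(z)=\Big(\tfrac1{2\pi}\big(\psi(1)-\ln\tfrac{\sqrt z}{2i}\big)\delta_{jk}+\widetilde G_{\sqrt z}(x_j-x_k)\Big)_{j,k=1}^m,\qquad \widetilde G_{\sqrt z}(x)=\begin{cases}\tfrac i4H^{(1)}_0(\sqrt z\,|x|),&x\ne0,\\0,&x=0;\end{cases}$$ (ii) for $\xi=\{\xi_j\}_{j=1}^m$ with $\xi_j\in\mathbb C^n$, $$\gamma(z)\xi=\sum_{j=1}^m\xi_j\,\tfrac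 i4H^{(1)}_0(\sqrt z\,r_j),\qquad r_j=|x-x_j|.$$ Here $\psi=\Gamma'/\Gamma$ is the digamma function, $H^{(1)}_0=J_0+iY_0$ is the Hankel function of the first kind and order $0$ (principal branch), $\ln$ is the principal logarithm, and $\sqrt z$ is the square root with $\operatorname{Im}\sqrt z>0$. -/

import Mathlib

open MeasureTheory Filter Topology
open scoped SchwartzMap Laplacian

noncomputable section

namespace PointInteraction

/-! ### Boundary triplets, γ-fields and Weyl functions -/

section Abstract

variable {𝔥 : Type*} [NormedAddCommGroup 𝔥] [InnerProductSpace ℂ 𝔥] [CompleteSpace 𝔥]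

/-- `A` is a closed densely defined symmetric operator. -/
def IsClosedSymmetric (A : 𝔥 →ₗ.[ℂ] 𝔥) : Prop :=
  Dense (A.domain : Set 𝔥) ∧ A.IsClosed ∧
    ∀ f g : A.domain, inner ℂ (g : 𝔥) (A f) = inner ℂ (A g) (f : 𝔥)

/-- The resolvent set of an unbounded operator `T`: those `z` for which `T - z` has an everywhere
defined bounded inverse `R`. -/
def opResolventSet (T : 𝔥 →ₗ.[ℂ] 𝔥) : Set ℂ :=
  {z | ∃ R : 𝔥 →L[ℂ] 𝔥,
    (∀ f : 𝔥, ∃ h : R f ∈ T.domain, T ⟨R f, h⟩ - z • R f = f) ∧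
    ∀ f : T.domain, R (T f - z • (f : 𝔥)) = f}

/-- The defect subspace `𝒩_z = ker (A* - z)`, as a subspace of `dom A*`. -/
def defectSubspace (A : 𝔥 →ₗ.[ℂ] 𝔥) (z : ℂ) : Submodule ℂ A.adjoint.domain :=
  LinearMap.ker (A.adjoint.toFun - z • A.adjoint.domain.subtype)

/-- Boundary triplets `{𝓗, Γ₀, Γ₁}` for the adjoint `A*` of a closed densely defined symmetric
operator `A`. Mathlib's inner products are linear in the second variable, so that
`inner ℂ g f` is what is commonly written `(f, g)`. -/
structure BoundaryTriplet (A : 𝔥 →ₗ.[ℂ] 𝔥) (𝓗 : Type*) [NormedAddCommGroup 𝓗]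
    [InnerProductSpace ℂ 𝓗] where
  Γ₀ : A.adjoint.domain →ₗ[ℂ] 𝓗
  Γ₁ : A.adjoint.domain →ₗ[ℂ] 𝓗
  /-- The second Green identity. -/
  green : ∀ f g : A.adjoint.domain,
    inner ℂ (g : 𝔥) (A.adjoint f) - inner ℂ (A.adjoint g) (f : 𝔥) =
      inner ℂ (Γ₀ g) (Γ₁ f) - inner ℂ (Γ₁ g) (Γ₀ f)
  surjective : Function.Surjective fun f : A.adjoint.domain => (Γ₀ f, Γ₁ f)

namespace BoundaryTriplet

variable {A : 𝔥 →ₗ.[ℂ] 𝔥} {𝓗 : Type*} [NormedAddCommGroup 𝓗] [InnerProductSpace ℂ 𝓗]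

/-- The extension `A₀ = A* ↾ ker Γ₀` of `A`. -/
def A₀ (B : BoundaryTriplet A 𝓗) : 𝔥 →ₗ.[ℂ] 𝔥 :=
  A.adjoint.domRestrict ((LinearMap.ker B.Γ₀).map A.adjoint.domain.subtype)

theorem mem_A₀ (B : BoundaryTriplet A 𝓗) (f : A.adjoint.domain) (hf : B.Γ₀ f = 0) :
    ∃ h : (f : 𝔥) ∈ B.A₀.domain, B.A₀ ⟨f, h⟩ = A.adjoint f := by
  have h : (f : 𝔥) ∈ B.A₀.domain :=
    ⟨⟨f, by simpa using hf, rfl⟩, f.2⟩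
  exact ⟨h, A.adjoint.domRestrict_apply (x := ⟨f, h⟩) (y := f) rfl⟩

/-- For `z ∈ ρ(A₀)` the map `Γ₀ ↾ 𝒩_z : 𝒩_z → 𝓗` is a bijection. -/
theorem bijective_defect (B : BoundaryTriplet A 𝓗) {z : ℂ} (hz : z ∈ opResolventSet B.A₀) :
    Function.Bijective (B.Γ₀.domRestrict (defectSubspace A z)) := by
  obtain ⟨R, hR₁, hR₂⟩ := hz
  constructor
  · rw [← LinearMap.ker_eq_bot, LinearMap.ker_eq_bot']
    rintro ⟨f, hf⟩ h0
    obtain ⟨h, hA⟩ := B.mem_A₀ f (by simpa using h0)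
    have h2 := hR₂ ⟨f, h⟩
    have h3 : A.adjoint f - z • (f : 𝔥) = 0 := by
      simpa [defectSubspace] using hf
    rw [hA, h3, map_zero] at h2
    exact Subtype.ext (Subtype.ext h2.symm)
  · intro ξ
    obtain ⟨f, hf⟩ := B.surjective (ξ, 0)
    obtain ⟨h, he⟩ := hR₁ (A.adjoint f - z • (f : 𝔥))
    obtain ⟨⟨g, hg0, hg⟩, -⟩ := id h
    have hg0' : B.Γ₀ g = 0 := hg0
    obtain ⟨h', hA⟩ := B.mem_A₀ g hg0'
    have hg' : (g : 𝔥) = R (A.adjoint f - z • (f : 𝔥)) := hg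
    have e : (⟨R (A.adjoint f - z • (f : 𝔥)), h⟩ : B.A₀.domain) = ⟨g, h'⟩ :=
      Subtype.ext hg'.symm
    rw [e, hA, ← hg'] at he
    refine ⟨⟨f - g, ?_⟩, ?_⟩
    · have : A.adjoint (f - g) - z • ((f : 𝔥) - g) = 0 := by
        rw [LinearPMap.map_sub, smul_sub]
        rw [← sub_eq_zero] at he
        rw [← neg_eq_zero, ← he]
        abel
      simpa [defectSubspace] using this
    · have := congrArg Prod.fst hf
      simpa [hg0'] using this

/-- `(Γ₀ ↾ 𝒩_z)⁻¹`, with values in `dom A*`. -/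
def gammaDom (B : BoundaryTriplet A 𝓗) (z : ℂ) (hz : z ∈ opResolventSet B.A₀) :
    𝓗 →ₗ[ℂ] A.adjoint.domain :=
  (defectSubspace A z).subtype ∘ₗ
    (LinearEquiv.ofBijective _ (B.bijective_defect hz)).symm.toLinearMap

/-- The `γ`-field `γ(z) = (Γ₀ ↾ 𝒩_z)⁻¹`, `z ∈ ρ(A₀)`. -/
def gammaField (B : BoundaryTriplet A 𝓗) (z : ℂ) (hz : z ∈ opResolventSet B.A₀) : 𝓗 →ₗ[ℂ] 𝔥 :=
  A.adjoint.domain.subtype ∘ₗ B.gammaDom z hz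

/-- The Weyl function `M(z) = Γ₁ γ(z)`, `z ∈ ρ(A₀)`. -/
def weyl (B : BoundaryTriplet A 𝓗) (z : ℂ) (hz : z ∈ opResolventSet B.A₀) : 𝓗 →ₗ[ℂ] 𝓗 :=
  B.Γ₁ ∘ₗ B.gammaDom z hz

end BoundaryTriplet

end Abstract

/-! ### The minimal Schrödinger operator in the plane -/

/-- The Euclidean plane `ℝ²`. -/
abbrev Plane := EuclideanSpace ℝ (Fin 2)

/-- The Hilbert space `L²(ℝ², ℂⁿ)`. -/
abbrev L2 (n : ℕ) := Lp (EuclideanSpace ℂ (Fin n)) 2 (volume : Measure Plane)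

/-- The boundary space `⊕_{j=1}^m ℂⁿ`. -/
abbrev BoundarySpace (m n : ℕ) := PiLp 2 fun _ : Fin m => EuclideanSpace ℂ (Fin n)

/-- The embedding of `L²(ℝ², ℂⁿ)` into the `ℂⁿ`-valued tempered distributions. -/
def toDistr (n : ℕ) : L2 n →ₗ[ℂ] 𝓢'(Plane, EuclideanSpace ℂ (Fin n)) :=
  (Lp.toTemperedDistributionCLM (EuclideanSpace ℂ (Fin n)) volume 2).toLinearMap

theorem toDistr_injective (n : ℕ) : Function.Injective (toDistr n) :=
  LinearMap.ker_eq_bot.mp (Lp.ker_toTemperedDistributionCLM_eq_bot (E := Plane)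
    (F := EuclideanSpace ℂ (Fin n)) (μ := volume) (p := 2))

/-- The Sobolev space `W²₂(ℝ², ℂⁿ)`. -/
def sobolev (n : ℕ) : Submodule ℂ (L2 n) where
  carrier := {f | TemperedDistribution.MemSobolev 2 2 (toDistr n f)}
  add_mem' {f g} hf hg := by
    rw [Set.mem_ofPred_eq, map_add]
    exact TemperedDistribution.MemSobolev.add hf hg
  zero_mem' := by
    rw [Set.mem_ofPred_eq, map_zero]
    exact TemperedDistribution.memSobolev_fun_zero _ _ _ _
  smul_mem' c f hf := by
    rw [Set.mem_ofPred_eq, map_smul]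
    exact TemperedDistribution.MemSobolev.smul c hf

theorem exists_laplacian {n : ℕ} (f : sobolev n) :
    ∃ g : L2 n, toDistr n g = Δ (toDistr n (f : L2 n)) := by
  have h := TemperedDistribution.MemSobolev.laplacian (show TemperedDistribution.MemSobolev 2 2
    (toDistr n (f : L2 n)) from f.2)
  rw [sub_self, TemperedDistribution.memSobolev_zero_iff] at h
  obtain ⟨g, hg⟩ := h
  exact ⟨g, hg.symm⟩

/-- The distributional Laplacian `Δ ⊗ I_n : W²₂(ℝ², ℂⁿ) → L²(ℝ², ℂⁿ)`. -/
def laplacian (n : ℕ) : sobolev n →ₗ[ℂ] L2 n where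
  toFun f := (exists_laplacian f).choose
  map_add' f g := by
    apply toDistr_injective
    rw [map_add, (exists_laplacian (f + g)).choose_spec, (exists_laplacian f).choose_spec,
      (exists_laplacian g).choose_spec, Submodule.coe_add, map_add]
    ext u
    simp [TemperedDistribution.laplacian_apply_apply]
  map_smul' c f := by
    apply toDistr_injective
    rw [RingHom.id_apply, map_smul, (exists_laplacian (c • f)).choose_spec,
      (exists_laplacian f).choose_spec, Submodule.coe_smul, map_smul]
    ext u
    simp [TemperedDistribution.laplacian_apply_apply]

theorem toDistr_laplacian {n : ℕ} (f : sobolev n) :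
    toDistr n (laplacian n f) = Δ (toDistr n (f : L2 n)) :=
  (exists_laplacian f).choose_spec

/-- The classes in `L²(ℝ², ℂⁿ)` that have a continuous representative vanishing at all `x_j`. -/
def vanishing (n : ℕ) {m : ℕ} (x : Fin m → Plane) : Submodule ℂ (L2 n) where
  carrier := {f | ∃ g : Plane → EuclideanSpace ℂ (Fin n), Continuous g ∧
    (f : Plane → EuclideanSpace ℂ (Fin n)) =ᵐ[volume] g ∧ ∀ j, g (x j) = 0}
  add_mem' := by
    rintro f₁ f₂ ⟨g₁, c₁, e₁, z₁⟩ ⟨g₂, c₂, e₂, z₂⟩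
    exact ⟨g₁ + g₂, c₁.add c₂, (Lp.coeFn_add f₁ f₂).trans (e₁.add e₂), fun j => by simp [z₁, z₂]⟩
  zero_mem' := ⟨0, continuous_const, Lp.coeFn_zero _ _ _, fun _ => rfl⟩
  smul_mem' := by
    rintro c f ⟨g, hc, e, hz⟩
    exact ⟨c • g, hc.const_smul c, (Lp.coeFn_smul c f).trans (e.const_smul c),
      fun j => by simp [hz]⟩

/-- The minimal Schrödinger operator `H = -Δ ⊗ I_n` with domain
`{f ∈ W²₂(ℝ², ℂⁿ) : f(x_j) = 0 for all j}`. -/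
def minimalOperator (n : ℕ) {m : ℕ} (x : Fin m → Plane) : L2 n →ₗ.[ℂ] L2 n :=
  (LinearPMap.mk (sobolev n) (-laplacian n)).domRestrict (vanishing n x)

/-- `B` is the triplet given by `Γ₀ f = -2π {lim_{y → x_j} f(y) / ln |y - x_j|}_j` and
`Γ₁ f = {lim_{y → x_j} (f(y) - ln |y - x_j| ξ_j)}_j`, where `ξ_j = lim_{y → x_j} f(y) / ln |y - x_j|`.
The limits are those of the (unique) representative `g` of `f` that is continuous
off the points `x_j`; its existence and that of the limits is part of the condition. -/
def IsPointTriplet {n m : ℕ} {x : Fin m → Plane}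
    (B : BoundaryTriplet (minimalOperator n x) (BoundarySpace m n)) : Prop :=
  ∀ f : (minimalOperator n x).adjoint.domain,
    ∃ (g : Plane → EuclideanSpace ℂ (Fin n)) (ξ : Fin m → EuclideanSpace ℂ (Fin n)),
      ((f : L2 n) : Plane → EuclideanSpace ℂ (Fin n)) =ᵐ[volume] g ∧
      ContinuousOn g (Set.range x)ᶜ ∧
      ∀ j, Tendsto (fun y => (Real.log ‖y - x j‖)⁻¹ • g y) (𝓝[≠] x j) (𝓝 (ξ j)) ∧
        B.Γ₀ f j = (-(2 * Real.pi)) • ξ j ∧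
        Tendsto (fun y => g y - Real.log ‖y - x j‖ • ξ j) (𝓝[≠] x j) (𝓝 (B.Γ₁ f j))

/-! ### The Hankel function and the matrix `M_s(z)` -/

/-- The Bessel function `J₀`. -/
def besselJ0 (w : ℂ) : ℂ :=
  ∑' k : ℕ, (-1) ^ k * (w / 2) ^ (2 * k) / (k.factorial : ℂ) ^ 2

/-- The principal branch of the Bessel function of the second kind `Y₀`. -/
def besselY0 (w : ℂ) : ℂ :=
  2 / Real.pi * (Complex.log (w / 2) + Real.eulerMascheroniConstant) * besselJ0 w -
    2 / Real.pi * ∑' k : ℕ, (-1) ^ k * (harmonic k : ℂ) * (w / 2) ^ (2 * k) /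
      (k.factorial : ℂ) ^ 2

/-- The principal branch of the Hankel function of the first kind `H₀⁽¹⁾ = J₀ + i Y₀`. -/
def hankel (w : ℂ) : ℂ := besselJ0 w + Complex.I * besselY0 w

/-- The square root `√z`. On the upper half-plane the principal branch is the one with
`Im √z > 0` and boundary value `√1 = 1`. -/
def sqrtC (z : ℂ) : ℂ := z ^ (1 / 2 : ℂ)

/-- The function `G̃_{√z}`. -/
def greenTilde (z : ℂ) (y : Plane) : ℂ :=
  if y = 0 then 0 else Complex.I / 4 * hankel (sqrtC z * (‖y‖ : ℂ))

/-- The matrix `M_s(z)` (the same for all `s`). -/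
def weylMatrix {m : ℕ} (x : Fin m → Plane) (z : ℂ) : Matrix (Fin m) (Fin m) ℂ :=
  Matrix.of fun j k =>
    1 / (2 * Real.pi) * (Complex.digamma 1 - Complex.log (sqrtC z / (2 * Complex.I))) *
        (if j = k then 1 else 0) +
      greenTilde z (x j - x k)

end PointInteraction

end

open PointInteraction

/-!
For `0 < Re κ` the Macdonald function gives the fundamental solution `K₀(κ |y|) / 2π` of `-Δ + κ²`.
Its heat kernel representation `∫₀^∞ (4πt)⁻¹ exp (-κ² t - |y|² / 4t) dt` (with the time rotated so
that it converges) yields its Fourier transform `(κ² + 4π² |ξ|²)⁻¹`, and hence the pairing of a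
point source `K₀(κ |· - x_j|) / 2π` with `φ ∈ L²` as the value at `x_j` of `(-Δ + κ²)⁻¹ φ`.
The functions orthogonal to all `φ` for which `(-Δ + κ²)⁻¹ φ` vanishes at the `x_j` are therefore
the combinations of point sources, so that `dom H*` is the direct sum of the range of
`(-Δ + κ²)⁻¹` and of these combinations, for every such `κ`.

On this decomposition the boundary values can be read off: the first summand is continuous, and
`K₀(κ r) = -ln (κ r / 2) - γ + o(1)` makes the coefficients of the point sources the value of `Γ₀`.
Green's identity reduces to the symmetry of the resolvent and of the matrix of constant terms. For
`κ = -i√z` the point sources span `ker (H* - z)`, which identifies the `γ`-field and the Weyl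
function. The power series of `K₀` turns them into Hankel functions; it is derived
from the modified Bessel equation, the two sides having the same behaviour at the origin.
-/

noncomputable section

namespace PointInteraction

open Set

/-! ### The Macdonald function -/

theorem one_add_sq_div_two_le_cosh (t : ℝ) : 1 + t ^ 2 / 2 ≤ Real.cosh t := by
  have half_angle : Real.cosh t = 1 + 2 * Real.sinh (t / 2) ^ 2 := by
    have := Real.cosh_two_mul (t / 2)
    rw [mul_div_cancel₀ _ (two_ne_zero' ℝ), Real.cosh_sq] at this
    linarith
  have : (t / 2) ^ 2 ≤ Real.sinh (t / 2) ^ 2 := by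
    rw [sq_le_sq, Real.abs_sinh]
    exact Real.self_le_sinh_iff.mpr (abs_nonneg _)
  linarith

theorem tendsto_cosh_atTop : Tendsto Real.cosh atTop atTop :=
  tendsto_atTop_mono one_add_sq_div_two_le_cosh <| tendsto_atTop_add_const_left _ _ <|
    (tendsto_pow_atTop two_ne_zero).atTop_div_const two_pos

theorem pow_le_factorial_mul_exp (k : ℕ) {a x : ℝ} (ha : 0 < a) (hx : 0 ≤ x) :
    x ^ k ≤ k.factorial / a ^ k * Real.exp (a * x) := by
  have := Real.pow_div_factorial_le_exp (a * x) (by positivity) k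
  rw [div_le_iff₀ (by positivity), mul_pow] at this
  rw [div_mul_eq_mul_div, le_div_iff₀ (by positivity)]
  linarith

theorem integrable_cosh_pow_mul_exp (k : ℕ) {a : ℝ} (ha : 0 < a) :
    Integrable fun t : ℝ => Real.cosh t ^ k * Real.exp (-a * Real.cosh t) := by
  set C : ℝ := k.factorial / (a / 2) ^ k
  refine ((integrable_exp_neg_mul_sq (b := a / 4) (by positivity)).const_mul C).mono'
    (by fun_prop) (ae_of_all _ fun t => ?_)
  have hc : 0 ≤ Real.cosh t := (Real.cosh_pos t).le
  rw [Real.norm_of_nonneg (by positivity)]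
  calc Real.cosh t ^ k * Real.exp (-a * Real.cosh t)
      ≤ C * Real.exp (a / 2 * Real.cosh t) * Real.exp (-a * Real.cosh t) := by
        gcongr
        exact pow_le_factorial_mul_exp k (half_pos ha) hc
    _ = C * Real.exp (-(a / 2) * Real.cosh t) := by
        rw [mul_assoc, ← Real.exp_add]
        ring_nf
    _ ≤ C * Real.exp (-(a / 4) * t ^ 2) := by
        refine mul_le_mul_of_nonneg_left (Real.exp_le_exp.mpr ?_) (by positivity)
        nlinarith [mul_le_mul_of_nonneg_left (one_add_sq_div_two_le_cosh t) (half_pos ha).le]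

/-- The moments `∫₀^∞ cosh(t)ᵏ exp(-w cosh t) dt`; `(-1)ᵏ` times the `k`-th one is the `k`-th
derivative of the Macdonald function `K₀`. -/
def macdonaldMoment (k : ℕ) (w : ℂ) : ℂ :=
  ∫ t : ℝ in Ioi 0, (Real.cosh t : ℂ) ^ k * Complex.exp (-w * Real.cosh t)

/-- The Macdonald function `K₀`, the modified Bessel function of the second kind, given on the
right half-plane by `K₀(w) = ∫₀^∞ exp(-w cosh t) dt`. -/
def macdonald (w : ℂ) : ℂ := macdonaldMoment 0 w

theorem norm_cosh_pow_mul_cexp (k : ℕ) (w : ℂ) (t : ℝ) :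
    ‖(Real.cosh t : ℂ) ^ k * Complex.exp (-w * Real.cosh t)‖ =
      Real.cosh t ^ k * Real.exp (-w.re * Real.cosh t) := by
  rw [norm_mul, norm_pow, Complex.norm_real, Real.norm_of_nonneg (Real.cosh_pos t).le,
    Complex.norm_exp, Complex.re_mul_ofReal, Complex.neg_re]

theorem integrable_cosh_pow_mul_cexp (k : ℕ) {w : ℂ} (hw : 0 < w.re) :
    Integrable fun t : ℝ => (Real.cosh t : ℂ) ^ k * Complex.exp (-w * Real.cosh t) :=
  (integrable_cosh_pow_mul_exp k hw).mono' (by fun_prop)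
    (ae_of_all _ fun t => (norm_cosh_pow_mul_cexp k w t).le)

theorem hasDerivAt_macdonaldMoment (k : ℕ) {w : ℂ} (hw : 0 < w.re) :
    HasDerivAt (macdonaldMoment k) (-macdonaldMoment (k + 1) w) w := by
  have hs : {v : ℂ | w.re / 2 < v.re} ∈ 𝓝 w :=
    (isOpen_lt continuous_const Complex.continuous_re).mem_nhds (half_lt_self hw)
  have h := hasDerivAt_integral_of_dominated_loc_of_deriv_le
    (μ := volume.restrict (Ioi (0 : ℝ)))
    (F := fun (v : ℂ) (t : ℝ) => (Real.cosh t : ℂ) ^ k * Complex.exp (-v * Real.cosh t))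
    (F' := fun (v : ℂ) (t : ℝ) => -((Real.cosh t : ℂ) ^ (k + 1) * Complex.exp (-v * Real.cosh t)))
    (bound := fun t => Real.cosh t ^ (k + 1) * Real.exp (-(w.re / 2) * Real.cosh t))
    hs (Eventually.of_forall fun v => by fun_prop) (integrable_cosh_pow_mul_cexp k hw).integrableOn
    (by fun_prop) (ae_of_all _ fun t v hv => ?_)
    (integrable_cosh_pow_mul_exp (k + 1) (by positivity)).integrableOn
    (ae_of_all _ fun t v _ => ?_)
  · have := h.2
    rw [integral_neg] at this
    exact this
  · rw [norm_neg, norm_cosh_pow_mul_cexp]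
    have := Real.cosh_pos t
    have hv' : w.re / 2 < v.re := hv
    gcongr
  · have hexp : HasDerivAt (fun v : ℂ => -v * (Real.cosh t : ℂ)) (-1 * (Real.cosh t : ℂ)) v :=
      (hasDerivAt_id v).neg.mul_const _
    convert! hexp.cexp.const_mul ((Real.cosh t : ℂ) ^ k) using 1
    ring

theorem hasDerivAt_macdonald {w : ℂ} (hw : 0 < w.re) :
    HasDerivAt macdonald (-macdonaldMoment 1 w) w :=
  hasDerivAt_macdonaldMoment 0 hw

theorem hasDerivAt_cexp_mul_cosh (w : ℂ) (t : ℝ) :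
    HasDerivAt (fun t : ℝ => Complex.exp (-w * Real.cosh t))
      (-w * Real.sinh t * Complex.exp (-w * Real.cosh t)) t := by
  convert! ((Real.hasDerivAt_cosh t).ofReal_comp.const_mul (-w)).cexp using 1
  ring

theorem tendsto_sinh_mul_cexp_neg_mul_cosh {w : ℂ} (hw : 0 < w.re) :
    Tendsto (fun t : ℝ => (Real.sinh t : ℂ) * Complex.exp (-w * Real.cosh t)) atTop (𝓝 0) := by
  have decay : Tendsto (fun s : ℝ => s * Real.exp (-w.re * s)) atTop (𝓝 0) := by
    have h := ((Real.tendsto_pow_mul_exp_neg_atTop_nhds_zero 1).comp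
      (tendsto_id.const_mul_atTop hw)).const_mul w.re⁻¹
    rw [mul_zero] at h
    refine h.congr fun s => ?_
    simp only [Function.comp, id]
    field_simp
  refine squeeze_zero_norm (fun t => ?_) (decay.comp tendsto_cosh_atTop)
  rw [norm_mul, Complex.norm_real, Complex.norm_exp, Complex.re_mul_ofReal, Complex.neg_re,
    Function.comp_apply]
  gcongr
  rw [Real.norm_eq_abs]
  exact abs_le_of_sq_le_sq (by nlinarith [Real.cosh_sq t]) (Real.cosh_pos t).le

/-- The modified Bessel equation `w K₀'' + K₀' = w K₀`. -/
theorem macdonaldMoment_ode {w : ℂ} (hw : 0 < w.re) :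
    w * macdonaldMoment 2 w - macdonaldMoment 1 w = w * macdonaldMoment 0 w := by
  let F (k : ℕ) (t : ℝ) : ℂ := (Real.cosh t : ℂ) ^ k * Complex.exp (-w * Real.cosh t)
  have hF (k : ℕ) : IntegrableOn (F k) (Ioi 0) := (integrable_cosh_pow_mul_cexp k hw).integrableOn
  have hderiv (t : ℝ) : HasDerivAt
      (fun t : ℝ => (Real.sinh t : ℂ) * Complex.exp (-w * Real.cosh t))
      (F 1 t + w * F 0 t - w * F 2 t) t := by
    convert! (Real.hasDerivAt_sinh t).ofReal_comp.mul (hasDerivAt_cexp_mul_cosh w t) using 1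
    have : (Real.cosh t : ℂ) ^ 2 = (Real.sinh t : ℂ) ^ 2 + 1 := mod_cast Real.cosh_sq t
    simp only [F, this]
    ring
  have hF₁₀ : IntegrableOn (fun t => F 1 t + w * F 0 t) (Ioi 0) :=
    (hF 1).add ((hF 0).const_mul w)
  have hint := integral_Ioi_of_hasDerivAt_of_tendsto' (a := 0) (fun t _ => hderiv t)
    (hF₁₀.sub ((hF 2).const_mul w)) (tendsto_sinh_mul_cexp_neg_mul_cosh hw)
  rw [integral_sub hF₁₀ ((hF 2).const_mul w), integral_add (hF 1) ((hF 0).const_mul w),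
    integral_const_mul, integral_const_mul, Real.sinh_zero, Complex.ofReal_zero, zero_mul,
    sub_zero] at hint
  simp only [macdonaldMoment]
  linear_combination -hint

theorem norm_mul_macdonaldMoment_one_sub_exp_le {r : ℝ} (hr : 0 < r) :
    ‖(r : ℂ) * macdonaldMoment 1 r - Complex.exp (-r)‖ ≤ r := by
  let E (t : ℝ) : ℂ := (Real.exp (-t) : ℂ) * Complex.exp (-r * Real.cosh t)
  have norm_E_le (t : ℝ) : ‖E t‖ ≤ Real.exp (-t) := by
    rw [norm_mul, Complex.norm_real, Real.norm_of_nonneg (Real.exp_pos _).le, Complex.norm_exp,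
      Complex.re_mul_ofReal, Complex.neg_re, Complex.ofReal_re]
    exact mul_le_of_le_one_right (Real.exp_pos _).le
      (Real.exp_le_one_iff.mpr (by nlinarith [Real.cosh_pos t]))
  have hE : IntegrableOn E (Ioi 0) :=
    (integrableOn_exp_neg_Ioi 0).mono' (by fun_prop) (ae_of_all _ norm_E_le)
  have hC := (integrable_cosh_pow_mul_cexp 1 (w := r) (by simpa)).integrableOn (s := Ioi 0)
  -- `cosh t - e⁻ᵗ = sinh t`, so the difference of the two integrands is an exact derivative
  have hderiv (t : ℝ) : HasDerivAt (fun t : ℝ => Complex.exp (-r * Real.cosh t))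
      (-r * ((Real.cosh t : ℂ) ^ 1 * Complex.exp (-r * Real.cosh t) - E t)) t := by
    convert! hasDerivAt_cexp_mul_cosh r t using 1
    have : (Real.sinh t : ℂ) = Real.cosh t - Real.exp (-t) := by
      rw [← Real.cosh_sub_sinh, ← Complex.ofReal_sub, sub_sub_cancel]
    rw [this]
    ring
  have hlim : Tendsto (fun t : ℝ => Complex.exp (-r * Real.cosh t)) atTop (𝓝 0) := by
    refine squeeze_zero_norm (fun t => le_of_eq ?_)
      (Real.tendsto_exp_neg_atTop_nhds_zero.comp (tendsto_cosh_atTop.const_mul_atTop hr))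
    simp [Complex.norm_exp]
  have hint := integral_Ioi_of_hasDerivAt_of_tendsto' (a := 0) (fun t _ => hderiv t)
    ((hC.sub hE).const_mul _) hlim
  rw [integral_const_mul, integral_sub hC hE, Real.cosh_zero, Complex.ofReal_one, mul_one] at hint
  have hrem : (r : ℂ) * macdonaldMoment 1 r - Complex.exp (-r) = r * ∫ t in Ioi 0, E t := by
    rw [macdonaldMoment]
    linear_combination -hint
  rw [hrem, norm_mul, Complex.norm_real, Real.norm_of_nonneg hr.le]
  refine mul_le_of_le_one_right hr.le ?_
  exact (norm_integral_le_of_norm_le (integrableOn_exp_neg_Ioi 0) (ae_of_all _ norm_E_le)).trans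
    integral_exp_neg_Ioi_zero.le

theorem tendsto_mul_macdonaldMoment_one :
    Tendsto (fun r : ℝ => (r : ℂ) * macdonaldMoment 1 r) (𝓝[>] 0) (𝓝 1) := by
  have hdiff : Tendsto (fun r : ℝ => (r : ℂ) * macdonaldMoment 1 r - Complex.exp (-r))
      (𝓝[>] 0) (𝓝 0) :=
    squeeze_zero_norm'
      (eventually_mem_nhdsWithin.mono fun _ hr => norm_mul_macdonaldMoment_one_sub_exp_le hr)
      (tendsto_id.mono_left nhdsWithin_le_nhds)
  have hexp : Tendsto (fun r : ℝ => Complex.exp (-r)) (𝓝[>] 0) (𝓝 1) := by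
    have : Continuous fun r : ℝ => Complex.exp (-r) := by fun_prop
    simpa using (this.tendsto 0).mono_left nhdsWithin_le_nhds
  simpa using hdiff.add hexp

/-- The exponential integral `E₁(ε) = ∫_ε^∞ e⁻ˢ / s ds`, which carries the logarithmic singularity
of `K₀`. -/
def expIntegral (ε : ℝ) : ℝ := ∫ s in Ioi ε, Real.exp (-s) / s

theorem integral_log_mul_exp_neg :
    ∫ s in Ioi (0 : ℝ), Real.log s * Real.exp (-s) = -Real.eulerMascheroniConstant := by
  have hGamma : HasDerivAt Complex.GammaIntegral (-Real.eulerMascheroniConstant : ℂ) 1 := by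
    refine Complex.hasDerivAt_Gamma_one.congr_of_eventuallyEq ?_
    filter_upwards [(isOpen_lt continuous_const Complex.continuous_re).mem_nhds
      (show 0 < (1 : ℂ).re by simp)] with s hs
    exact (Complex.Gamma_eq_integral hs).symm
  have h := (Complex.hasDerivAt_GammaIntegral (s := 1) (by simp)).unique hGamma
  rw [← Complex.ofReal_inj, Complex.ofReal_neg, ← h, ← integral_complex_ofReal]
  simp

theorem integrableOn_log_mul_exp_neg :
    IntegrableOn (fun s : ℝ => Real.log s * Real.exp (-s)) (Ioi 0) := by
  by_contra h
  have := integral_log_mul_exp_neg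
  rw [integral_undef h] at this
  linarith [Real.one_half_lt_eulerMascheroniConstant]

theorem integrableOn_exp_neg_div {ε : ℝ} (hε : 0 < ε) :
    IntegrableOn (fun s : ℝ => Real.exp (-s) / s) (Ioi ε) := by
  refine ((integrableOn_exp_neg_Ioi ε).const_mul ε⁻¹).mono'
    (Measurable.aestronglyMeasurable (by fun_prop)) ?_
  filter_upwards [ae_restrict_mem measurableSet_Ioi] with s (hs : ε < s)
  have : 0 < s := hε.trans hs
  rw [Real.norm_of_nonneg (by positivity), div_eq_inv_mul]
  gcongr

theorem expIntegral_eq_integral_log {ε : ℝ} (hε : 0 < ε) :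
    expIntegral ε =
      (∫ s in Ioi ε, Real.log s * Real.exp (-s)) - Real.exp (-ε) * Real.log ε := by
  have hlog : IntegrableOn (fun s : ℝ => Real.log s * Real.exp (-s)) (Ioi ε) :=
    integrableOn_log_mul_exp_neg.mono_set (Ioi_subset_Ioi hε.le)
  have hderiv : ∀ s ∈ Ici ε, HasDerivAt (fun s => Real.exp (-s) * Real.log s)
      (Real.exp (-s) / s - Real.log s * Real.exp (-s)) s := by
    intro s hs
    convert! (hasDerivAt_id s).neg.exp.mul (Real.hasDerivAt_log (hε.trans_le hs).ne') using 1
    simp only [id, Pi.neg_apply]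
    ring
  have hlim : Tendsto (fun s => Real.exp (-s) * Real.log s) atTop (𝓝 0) := by
    refine squeeze_zero_norm' ?_ (Real.tendsto_pow_mul_exp_neg_atTop_nhds_zero 1)
    filter_upwards [eventually_ge_atTop 1] with s hs
    rw [Real.norm_of_nonneg (mul_nonneg (Real.exp_pos _).le (Real.log_nonneg hs)), mul_comm,
      pow_one]
    gcongr
    exact Real.log_le_self (by linarith)
  have hint := integral_Ioi_of_hasDerivAt_of_tendsto' hderiv
    ((integrableOn_exp_neg_div hε).sub hlog) hlim
  rw [integral_sub (integrableOn_exp_neg_div hε) hlog] at hint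
  rw [expIntegral]
  linarith

theorem tendsto_setIntegral_log_mul_exp_neg :
    Tendsto (fun ε : ℝ => ∫ s in Ioi ε, Real.log s * Real.exp (-s)) (𝓝[>] 0)
      (𝓝 (-Real.eulerMascheroniConstant)) := by
  rw [← integral_log_mul_exp_neg]
  have hcover := aecover_Ioi_of_Ioi (μ := volume) (A := (0 : ℝ)) (a := id) (l := 𝓝[>] 0)
    nhdsWithin_le_nhds
  refine (hcover.integral_tendsto_of_countably_generated integrableOn_log_mul_exp_neg).congr' ?_
  filter_upwards [eventually_mem_nhdsWithin] with ε (hε : 0 < ε)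
  rw [Measure.restrict_restrict measurableSet_Ioi, id,
    inter_eq_left.mpr (Ioi_subset_Ioi hε.le)]

theorem tendsto_one_sub_exp_neg_mul_log :
    Tendsto (fun ε : ℝ => (1 - Real.exp (-ε)) * Real.log ε) (𝓝[>] 0) (𝓝 0) := by
  have hlog : Tendsto (fun ε : ℝ => ‖Real.log ε * ε‖) (𝓝[>] 0) (𝓝 0) := by
    simpa using (tendsto_log_mul_rpow_nhdsGT_zero (r := 1) one_pos).norm
  refine squeeze_zero_norm' ?_ hlog
  filter_upwards [eventually_mem_nhdsWithin] with ε (hε : 0 < ε)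
  rw [norm_mul, norm_mul, mul_comm]
  gcongr
  rw [Real.norm_of_nonneg (by linarith [Real.exp_le_one_iff.mpr (neg_nonpos.mpr hε.le)]),
    Real.norm_of_nonneg hε.le]
  linarith [Real.add_one_le_exp (-ε)]

theorem tendsto_expIntegral_add_log :
    Tendsto (fun ε : ℝ => expIntegral ε + Real.log ε) (𝓝[>] 0)
      (𝓝 (-Real.eulerMascheroniConstant)) := by
  have h := tendsto_setIntegral_log_mul_exp_neg.add tendsto_one_sub_exp_neg_mul_log
  rw [add_zero] at h
  refine h.congr' ?_
  filter_upwards [eventually_mem_nhdsWithin] with ε hε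
  rw [expIntegral_eq_integral_log hε]
  ring

section ExponentialSubstitution

variable {ε : ℝ}

theorem image_mul_exp_Ioi_zero (hε : 0 < ε) : (fun t => ε * Real.exp t) '' Ioi 0 = Ioi ε := by
  ext s
  simp only [mem_image, mem_Ioi]
  constructor
  · rintro ⟨t, ht, rfl⟩
    exact lt_mul_of_one_lt_right hε (Real.one_lt_exp_iff.mpr ht)
  · intro hs
    refine ⟨Real.log (s / ε), Real.log_pos ((one_lt_div hε).mpr hs), ?_⟩
    rw [Real.exp_log (div_pos (hε.trans hs) hε), mul_div_cancel₀ _ hε.ne']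

theorem injective_mul_exp (hε : 0 < ε) : Function.Injective fun t => ε * Real.exp t :=
  (mul_right_injective₀ hε.ne').comp Real.exp_injective

theorem abs_mul_exp_smul_exp_neg_div (hε : 0 < ε) (t : ℝ) :
    |ε * Real.exp t| • (Real.exp (-(ε * Real.exp t)) / (ε * Real.exp t)) =
      Real.exp (-(ε * Real.exp t)) := by
  have : 0 < ε * Real.exp t := by positivity
  rw [abs_of_pos this, smul_eq_mul, mul_div_cancel₀ _ this.ne']

theorem hasDerivWithinAt_mul_exp (s : Set ℝ) (t : ℝ) :
    HasDerivWithinAt (fun t => ε * Real.exp t) (ε * Real.exp t) s t :=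
  ((Real.hasDerivAt_exp t).const_mul ε).hasDerivWithinAt

theorem integrableOn_exp_neg_mul_exp (hε : 0 < ε) :
    IntegrableOn (fun t => Real.exp (-(ε * Real.exp t))) (Ioi 0) := by
  have h := (integrableOn_image_iff_integrableOn_abs_deriv_smul measurableSet_Ioi
    (fun t _ => hasDerivWithinAt_mul_exp (Ioi 0) t) (injective_mul_exp hε).injOn
    fun s => Real.exp (-s) / s).mp
      (by rw [image_mul_exp_Ioi_zero hε]; exact integrableOn_exp_neg_div hε)
  simpa only [abs_mul_exp_smul_exp_neg_div hε] using h

theorem integral_exp_neg_mul_exp (hε : 0 < ε) :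
    ∫ t in Ioi 0, Real.exp (-(ε * Real.exp t)) = expIntegral ε := by
  rw [expIntegral, ← image_mul_exp_Ioi_zero hε,
    integral_image_eq_integral_abs_deriv_smul measurableSet_Ioi
      (fun t _ => hasDerivWithinAt_mul_exp (Ioi 0) t) (injective_mul_exp hε).injOn]
  simp only [abs_mul_exp_smul_exp_neg_div hε]

end ExponentialSubstitution

theorem abs_exp_neg_add_sub_exp_neg_le {a b : ℝ} (ha : 0 ≤ a) (hb : 0 ≤ b) :
    |Real.exp (-(a + b)) - Real.exp (-a)| ≤ b := by
  have h : Real.exp (-(a + b)) - Real.exp (-a) = -(Real.exp (-a) * (1 - Real.exp (-b))) := by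
    rw [neg_add, Real.exp_add]
    ring
  have ha' : Real.exp (-a) ≤ 1 := Real.exp_le_one_iff.mpr (neg_nonpos.mpr ha)
  have hb' : 0 ≤ 1 - Real.exp (-b) := by linarith [Real.exp_le_one_iff.mpr (neg_nonpos.mpr hb)]
  rw [h, abs_neg, abs_of_nonneg (mul_nonneg (Real.exp_pos _).le hb')]
  calc Real.exp (-a) * (1 - Real.exp (-b)) ≤ 1 * (1 - Real.exp (-b)) := by gcongr
    _ ≤ b := by linarith [Real.add_one_le_exp (-b)]

theorem norm_macdonald_sub_expIntegral_le {r : ℝ} (hr : 0 < r) :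
    ‖macdonald r - expIntegral (r / 2)‖ ≤ r / 2 := by
  have hK := (integrable_cosh_pow_mul_cexp 0 (w := r) (by simpa)).integrableOn (s := Ioi 0)
  have hE : IntegrableOn (fun t => (Real.exp (-(r / 2 * Real.exp t)) : ℂ)) (Ioi 0) :=
    (integrableOn_exp_neg_mul_exp (half_pos hr)).ofReal
  rw [← integral_exp_neg_mul_exp (half_pos hr), macdonald, macdonaldMoment,
    ← integral_complex_ofReal, ← integral_sub hK hE]
  have hbound (t : ℝ) : ‖(Real.cosh t : ℂ) ^ 0 * Complex.exp (-r * Real.cosh t) -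
      (Real.exp (-(r / 2 * Real.exp t)) : ℂ)‖ ≤ r / 2 * Real.exp (-t) := by
    have hsplit : Complex.exp (-r * Real.cosh t) =
        (Real.exp (-(r / 2 * Real.exp t + r / 2 * Real.exp (-t))) : ℂ) := by
      rw [Real.cosh_eq]
      push_cast
      congr 1
      ring
    rw [pow_zero, one_mul, hsplit, ← Complex.ofReal_sub, Complex.norm_real, Real.norm_eq_abs]
    exact abs_exp_neg_add_sub_exp_neg_le (by positivity) (by positivity)
  refine (norm_integral_le_of_norm_le ((integrableOn_exp_neg_Ioi 0).const_mul (r / 2))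
    (ae_of_all _ hbound)).trans ?_
  rw [integral_const_mul, integral_exp_neg_Ioi_zero, mul_one]

theorem tendsto_const_mul_nhdsGT_zero {a : ℝ} (ha : 0 < a) :
    Tendsto (fun r : ℝ => a * r) (𝓝[>] 0) (𝓝[>] 0) := by
  refine tendsto_nhdsWithin_iff.mpr ⟨?_, ?_⟩
  · simpa using (tendsto_id.const_mul a).mono_left (nhdsWithin_le_nhds (a := (0 : ℝ)))
  · filter_upwards [eventually_mem_nhdsWithin] with r hr
    exact mul_pos ha hr

theorem tendsto_macdonald_add_log :
    Tendsto (fun r : ℝ => macdonald r + Real.log (r / 2)) (𝓝[>] 0)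
      (𝓝 (-Real.eulerMascheroniConstant : ℂ)) := by
  have hhalf : Tendsto (fun r : ℝ => r / 2) (𝓝[>] 0) (𝓝[>] 0) := by
    simpa only [div_eq_inv_mul] using tendsto_const_mul_nhdsGT_zero (inv_pos.mpr two_pos)
  have hdiff : Tendsto (fun r : ℝ => macdonald r - expIntegral (r / 2)) (𝓝[>] 0) (𝓝 0) :=
    squeeze_zero_norm'
      (eventually_mem_nhdsWithin.mono fun _ hr => norm_macdonald_sub_expIntegral_le hr)
      (hhalf.mono_right nhdsWithin_le_nhds)
  have hE := (Complex.continuous_ofReal.tendsto _).comp (tendsto_expIntegral_add_log.comp hhalf)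
  have h := hdiff.add hE
  rw [zero_add, Complex.ofReal_neg] at h
  refine h.congr fun r => ?_
  simp only [Function.comp]
  push_cast
  ring

/-! ### Bessel series and the Hankel function -/

/-- The entire function `Σ cₖ qᵏ / (k!)²`; for `c = 1` and `q = w² / 4` it is the modified Bessel
function `I₀(w)`. -/
def besselSeries (c : ℕ → ℂ) (q : ℂ) : ℂ := ∑' k : ℕ, c k * q ^ k / (k.factorial : ℂ) ^ 2

/-- The coefficient sequences `c` for which `besselSeries c` converges on the whole plane. -/
def IsBesselCoeff (c : ℕ → ℂ) : Prop :=
  ∀ q : ℂ, Summable fun k : ℕ => c k * q ^ k / (k.factorial : ℂ) ^ 2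

/-- The coefficients of the derivative of `besselSeries c`. -/
def derivCoeff (c : ℕ → ℂ) (k : ℕ) : ℂ := c (k + 1) / (k + 1)

/-- The harmonic numbers, which are the coefficients of the non-logarithmic part of `Y₀` and
`K₀`. -/
def harmonicCoeff (k : ℕ) : ℂ := harmonic k

@[simp]
theorem besselSeries_zero (c : ℕ → ℂ) : besselSeries c 0 = c 0 := by
  rw [besselSeries, tsum_eq_single 0 fun k hk => by simp [hk]]
  simp

theorem isBesselCoeff_of_norm_le_two_pow {c : ℕ → ℂ} (hc : ∀ k, ‖c k‖ ≤ 2 ^ k) :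
    IsBesselCoeff c := by
  intro q
  refine Summable.of_norm_bounded (Real.summable_pow_div_factorial (2 * ‖q‖)) fun k => ?_
  have hfact : (1 : ℝ) ≤ k.factorial := mod_cast k.factorial_pos
  rw [norm_div, norm_mul, norm_pow, norm_pow, Complex.norm_natCast, mul_pow]
  gcongr
  · exact hc k
  · exact le_self_pow₀ hfact two_ne_zero

theorem isBesselCoeff_one : IsBesselCoeff 1 :=
  isBesselCoeff_of_norm_le_two_pow fun k => by simpa using one_le_pow₀ (n := k) one_le_two

theorem norm_harmonicCoeff_le (k : ℕ) : ‖harmonicCoeff k‖ ≤ k := by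
  induction k with
  | zero => simp [harmonicCoeff]
  | succ k ih =>
    have h : ‖((k + 1 : ℕ) : ℂ)⁻¹‖ ≤ 1 := by
      rw [norm_inv, Complex.norm_natCast]
      exact inv_le_one_of_one_le₀ (mod_cast k.succ_pos)
    rw [harmonicCoeff, harmonic_succ]
    push_cast at h ⊢
    exact (norm_add_le _ _).trans (add_le_add ih h)

theorem isBesselCoeff_harmonicCoeff : IsBesselCoeff harmonicCoeff :=
  isBesselCoeff_of_norm_le_two_pow fun k =>
    (norm_harmonicCoeff_le k).trans (mod_cast Nat.lt_two_pow_self.le)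

namespace IsBesselCoeff

variable {c : ℕ → ℂ}

/-- On `|q| ≤ R` the series is dominated by its value at `R`, so it converges locally uniformly. -/
theorem norm_term_le {R : ℝ} (k : ℕ) {q : ℂ} (hq : ‖q‖ ≤ R) :
    ‖c k * q ^ k / (k.factorial : ℂ) ^ 2‖ ≤ ‖c k * (R : ℂ) ^ k / (k.factorial : ℂ) ^ 2‖ := by
  have hR : 0 ≤ R := (norm_nonneg q).trans hq
  simp only [norm_div, norm_mul, norm_pow, Complex.norm_real, Real.norm_of_nonneg hR]
  gcongr

theorem differentiable (hc : IsBesselCoeff c) : Differentiable ℂ (besselSeries c) := fun q =>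
  (Complex.differentiableOn_tsum_of_summable_norm (hc (‖q‖ + 1 : ℝ)).norm
    (fun _ => by fun_prop) Metric.isOpen_ball
    fun k _ hw => norm_term_le k (mem_ball_zero_iff.mp hw).le).differentiableAt
    (Metric.isOpen_ball.mem_nhds (mem_ball_zero_iff.mpr (lt_add_one _)))

theorem hasSum_deriv (hc : IsBesselCoeff c) (q : ℂ) :
    HasSum (fun k : ℕ => derivCoeff c k * q ^ k / (k.factorial : ℂ) ^ 2)
      (deriv (besselSeries c) q) := by
  have h := Complex.hasSum_deriv_of_summable_norm (z := q)
    (F := fun k q => c k * q ^ k / (k.factorial : ℂ) ^ 2) (hc (‖q‖ + 1 : ℝ)).norm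
    (fun _ => by fun_prop) Metric.isOpen_ball
    (fun k _ hw => norm_term_le k (mem_ball_zero_iff.mp hw).le)
    (mem_ball_zero_iff.mpr (lt_add_one _))
  rw [← hasSum_nat_add_iff' 1] at h
  convert! h using 1
  · ext k
    have : (k + 1 : ℂ) ≠ 0 := mod_cast k.succ_ne_zero
    simp only [deriv_div_const, deriv_const_mul_field', deriv_pow_field, derivCoeff,
      Nat.factorial_succ, Nat.add_sub_cancel]
    push_cast
    field_simp
  · rw [Finset.sum_range_one]
    simp only [pow_zero, mul_one, Nat.factorial_zero, Nat.cast_one, one_pow, div_one, deriv_const,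
      sub_zero]
    rfl

protected theorem deriv (hc : IsBesselCoeff c) : IsBesselCoeff (derivCoeff c) :=
  fun q => (hc.hasSum_deriv q).summable

theorem hasDerivAt (hc : IsBesselCoeff c) (q : ℂ) :
    HasDerivAt (besselSeries c) (besselSeries (derivCoeff c) q) q :=
  (hc.differentiable q).hasDerivAt.congr_deriv (hc.hasSum_deriv q).tsum_eq.symm

theorem besselSeries_ode (hc : IsBesselCoeff c) (q : ℂ) :
    q * besselSeries (derivCoeff (derivCoeff c)) q + besselSeries (derivCoeff c) q =
      besselSeries (fun k => c (k + 1)) q := by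
  have h₁ := hc.deriv q
  have h₂ := hc.deriv.deriv q
  have hterm (k : ℕ) : c (k + 1 + 1) * q ^ (k + 1) / ((k + 1).factorial : ℂ) ^ 2 =
      q * (derivCoeff (derivCoeff c) k * q ^ k / (k.factorial : ℂ) ^ 2) +
        derivCoeff c (k + 1) * q ^ (k + 1) / ((k + 1).factorial : ℂ) ^ 2 := by
    have : (k + 1 : ℂ) ≠ 0 := mod_cast k.succ_ne_zero
    have : (k + 1 + 1 : ℂ) ≠ 0 := mod_cast (k + 1).succ_ne_zero
    simp only [derivCoeff, Nat.factorial_succ]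
    push_cast
    field_simp
    ring
  have hsum : HasSum (fun k => c (k + 1) * q ^ k / (k.factorial : ℂ) ^ 2)
      (q * besselSeries (derivCoeff (derivCoeff c)) q + besselSeries (derivCoeff c) q) := by
    rw [← hasSum_nat_add_iff' 1]
    convert! (h₂.hasSum.mul_left q).add ((hasSum_nat_add_iff' 1).mpr h₁.hasSum) using 1
    · exact funext hterm
    · simp [besselSeries, derivCoeff, add_sub_assoc]
  exact hsum.tsum_eq.symm

end IsBesselCoeff

/-- The even entire function `w ↦ besselSeries c (w² / 4)`. -/
def modifiedSeries (c : ℕ → ℂ) (w : ℂ) : ℂ := besselSeries c (w ^ 2 / 4)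

/-- The Euler derivative `w ↦ w f'(w)` of `f = modifiedSeries c`. -/
def eulerModifiedSeries (c : ℕ → ℂ) (w : ℂ) : ℂ :=
  w ^ 2 / 2 * besselSeries (derivCoeff c) (w ^ 2 / 4)

@[simp]
theorem modifiedSeries_zero (c : ℕ → ℂ) : modifiedSeries c 0 = c 0 := by
  simp [modifiedSeries]

@[simp]
theorem eulerModifiedSeries_zero (c : ℕ → ℂ) : eulerModifiedSeries c 0 = 0 := by
  simp [eulerModifiedSeries]

namespace IsBesselCoeff

variable {c : ℕ → ℂ}

theorem hasDerivAt_comp_sq (hc : IsBesselCoeff c) (w : ℂ) :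
    HasDerivAt (modifiedSeries c) (w / 2 * besselSeries (derivCoeff c) (w ^ 2 / 4)) w := by
  have hsq : HasDerivAt (fun w : ℂ => w ^ 2 / 4) (w / 2) w :=
    ((hasDerivAt_pow 2 w).div_const 4).congr_deriv (by norm_num; ring)
  exact ((hc.hasDerivAt _).comp w hsq).congr_deriv (mul_comm _ _)

theorem differentiable_modifiedSeries (hc : IsBesselCoeff c) :
    Differentiable ℂ (modifiedSeries c) :=
  fun w => (hc.hasDerivAt_comp_sq w).differentiableAt

theorem hasDerivAt_modifiedSeries (hc : IsBesselCoeff c) {w : ℂ} (hw : w ≠ 0) :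
    HasDerivAt (modifiedSeries c) (eulerModifiedSeries c w / w) w :=
  (hc.hasDerivAt_comp_sq w).congr_deriv (by rw [eulerModifiedSeries]; field_simp)

theorem hasDerivAt_eulerModifiedSeries (hc : IsBesselCoeff c) (w : ℂ) :
    HasDerivAt (eulerModifiedSeries c) (w * modifiedSeries (fun k => c (k + 1)) w) w := by
  have hsq : HasDerivAt (fun w : ℂ => w ^ 2 / 2) w w :=
    ((hasDerivAt_pow 2 w).div_const 2).congr_deriv (by norm_num)
  refine (hsq.mul (hc.deriv.hasDerivAt_comp_sq w)).congr_deriv ?_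
  simp only [modifiedSeries, ← hc.besselSeries_ode]
  ring

end IsBesselCoeff

theorem modifiedSeries_one_ne_zero (r : ℝ) : modifiedSeries 1 r ≠ 0 := by
  have hterm (k : ℕ) : (1 : ℕ → ℂ) k * ((r : ℂ) ^ 2 / 4) ^ k / (k.factorial : ℂ) ^ 2 =
      (((r ^ 2 / 4) ^ k / (k.factorial : ℝ) ^ 2 : ℝ) : ℂ) := by
    push_cast
    rw [Pi.one_apply, one_mul]
  have hsum : Summable fun k : ℕ => (r ^ 2 / 4) ^ k / (k.factorial : ℝ) ^ 2 :=
    Complex.summable_ofReal.mp ((isBesselCoeff_one _).congr hterm)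
  rw [modifiedSeries, besselSeries, tsum_congr hterm, ← Complex.ofReal_tsum, Complex.ofReal_ne_zero]
  exact (hsum.tsum_pos (fun k => by positivity) 0 (by simp)).ne'

theorem modifiedSeries_harmonicCoeff_succ (w : ℂ) :
    modifiedSeries (fun k => harmonicCoeff (k + 1)) w =
      modifiedSeries harmonicCoeff w + besselSeries (derivCoeff 1) (w ^ 2 / 4) := by
  simp only [modifiedSeries, besselSeries]
  rw [← (isBesselCoeff_harmonicCoeff _).tsum_add (isBesselCoeff_one.deriv _)]
  refine tsum_congr fun k => ?_
  simp only [harmonicCoeff, harmonic_succ, derivCoeff, Pi.one_apply]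
  push_cast
  ring

theorem besselJ0_eq_besselSeries (w : ℂ) : besselJ0 w = besselSeries 1 (-(w ^ 2 / 4)) := by
  refine tsum_congr fun k => ?_
  rw [neg_eq_neg_one_mul (w ^ 2 / 4), mul_pow, pow_mul, Pi.one_apply, one_mul]
  congr 3
  ring

theorem besselY0_eq_besselSeries (w : ℂ) : besselY0 w =
    2 / Real.pi * (Complex.log (w / 2) + Real.eulerMascheroniConstant) *
      besselSeries 1 (-(w ^ 2 / 4)) -
    2 / Real.pi * besselSeries harmonicCoeff (-(w ^ 2 / 4)) := by
  rw [besselY0, besselJ0_eq_besselSeries]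
  congr 2
  refine tsum_congr fun k => ?_
  rw [neg_eq_neg_one_mul (w ^ 2 / 4), mul_pow, pow_mul, harmonicCoeff,
    show (w / 2) ^ 2 = w ^ 2 / 4 by ring]
  ring

/-! ### The expansion of the Macdonald function at the origin -/

theorem tendsto_log_smul_sub {E : Type*} [NormedAddCommGroup E] [NormedSpace ℝ E] {f : ℝ → E}
    (hf : DifferentiableAt ℝ f 0) :
    Tendsto (fun r => Real.log r • (f r - f 0)) (𝓝[>] 0) (𝓝 0) := by
  have hlog : Tendsto (fun r : ℝ => Real.log r * r) (𝓝[>] 0) (𝓝 0) := by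
    simpa using tendsto_log_mul_rpow_nhdsGT_zero one_pos
  have hslope : Tendsto (slope f 0) (𝓝[>] 0) (𝓝 (deriv f 0)) :=
    hf.hasDerivAt.tendsto_slope.mono_left
      (nhdsWithin_mono 0 fun r (hr : 0 < r) => hr.ne')
  refine (zero_smul ℝ (deriv f 0) ▸ hlog.smul hslope).congr fun r => ?_
  rw [mul_smul, ← vsub_eq_sub (f r), ← sub_smul_slope f 0 r, sub_zero]

theorem eq_of_hasDerivAt_zero_of_tendsto {E : Type*} [NormedAddCommGroup E] [NormedSpace ℝ E]
    {f : ℝ → E} {a : E} (hf : ∀ r, 0 < r → HasDerivAt f 0 r) (ha : Tendsto f (𝓝[>] 0) (𝓝 a))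
    {r : ℝ} (hr : 0 < r) : f r = a := by
  have hconst : ∀ s ∈ Ioi (0 : ℝ), f s = f r := fun s hs =>
    isOpen_Ioi.is_const_of_deriv_eq_zero isPreconnected_Ioi
      (fun s hs => (hf s hs).differentiableAt.differentiableWithinAt)
      (fun s hs => (hf s hs).deriv) hs hr
  refine tendsto_nhds_unique (tendsto_const_nhds.congr' ?_) ha
  exact eventually_mem_nhdsWithin.mono fun s hs => (hconst s hs).symm

theorem tendsto_ofReal_nhdsGT_zero {f : ℂ → ℂ} (hf : ContinuousAt f 0) :
    Tendsto (fun r : ℝ => f r) (𝓝[>] 0) (𝓝 (f 0)) :=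
  hf.tendsto.comp (Complex.continuous_ofReal.tendsto' 0 0 rfl |>.mono_left nhdsWithin_le_nhds)

/-- The pair `u`, `p = r u'` solves the modified Bessel equation, and so does `I₀`. As the
Wronskian of the two solutions vanishes, `u` is a multiple of `I₀`. -/
theorem eq_zero_of_modifiedBessel {u p : ℝ → ℂ} (hu : ∀ r, 0 < r → HasDerivAt u (p r / r) r)
    (hp : ∀ r, 0 < r → HasDerivAt p (r * u r) r) (hu₀ : Tendsto u (𝓝[>] 0) (𝓝 0))
    (hp₀ : Tendsto p (𝓝[>] 0) (𝓝 0)) {r : ℝ} (hr : 0 < r) : u r = 0 := by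
  have hI (r : ℝ) (hr : 0 < r) : HasDerivAt (fun r : ℝ => modifiedSeries 1 r)
      (eulerModifiedSeries 1 r / r) r :=
    (isBesselCoeff_one.hasDerivAt_modifiedSeries (mod_cast hr.ne')).comp_ofReal
  have hQ (r : ℝ) : HasDerivAt (fun r : ℝ => eulerModifiedSeries 1 r) (r * modifiedSeries 1 r) r :=
    (isBesselCoeff_one.hasDerivAt_eulerModifiedSeries r).comp_ofReal
  have hI₀ := tendsto_ofReal_nhdsGT_zero
    (isBesselCoeff_one.differentiable_modifiedSeries 0).continuousAt
  have hQ₀ := tendsto_ofReal_nhdsGT_zero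
    (isBesselCoeff_one.hasDerivAt_eulerModifiedSeries 0).continuousAt
  have wronskian (r : ℝ) (hr : 0 < r) :
      p r * modifiedSeries 1 r - u r * eulerModifiedSeries 1 r = 0 := by
    refine eq_of_hasDerivAt_zero_of_tendsto
      (f := fun r => p r * modifiedSeries 1 r - u r * eulerModifiedSeries 1 r) (fun r hr => ?_)
      (by simpa using (hp₀.mul hI₀).sub (hu₀.mul hQ₀)) hr
    have hr' : (r : ℂ) ≠ 0 := mod_cast hr.ne'
    refine (((hp r hr).mul (hI r hr)).sub ((hu r hr).mul (hQ r))).congr_deriv ?_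
    field_simp
    ring
  have hquot : u r / modifiedSeries 1 r = 0 := by
    refine eq_of_hasDerivAt_zero_of_tendsto (f := fun r => u r / modifiedSeries 1 r)
      (fun r hr => ?_) (by simpa using! hu₀.div hI₀ (by simp)) hr
    refine ((hu r hr).div (hI r hr) (modifiedSeries_one_ne_zero r)).congr_deriv ?_
    rw [div_mul_eq_mul_div, mul_div_assoc', ← sub_div, wronskian r hr, zero_div, zero_div]
  simpa [modifiedSeries_one_ne_zero] using hquot

/-- The series expansion of `K₀`. -/
def macdonaldSeries (w : ℂ) : ℂ :=
  -(Complex.log (w / 2) + Real.eulerMascheroniConstant) * modifiedSeries 1 w +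
    modifiedSeries harmonicCoeff w

/-- The Euler derivative `w ↦ w f'(w)` of `f = macdonaldSeries`. -/
def eulerMacdonaldSeries (w : ℂ) : ℂ :=
  -(Complex.log (w / 2) + Real.eulerMascheroniConstant) * eulerModifiedSeries 1 w -
    modifiedSeries 1 w + eulerModifiedSeries harmonicCoeff w

theorem hasDerivAt_neg_log_half_add {w : ℂ} (hw : 0 < w.re) (a : ℂ) :
    HasDerivAt (fun w => -(Complex.log (w / 2) + a)) (-w⁻¹) w := by
  have hw₀ : w ≠ 0 := fun h => by simp [h] at hw
  have hslit : w / 2 ∈ Complex.slitPlane := Or.inl (by simpa using hw)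
  refine ((((hasDerivAt_id w).div_const 2).clog hslit).add_const a).neg.congr_deriv ?_
  simp only [id_eq]
  field_simp

theorem hasDerivAt_macdonaldSeries {w : ℂ} (hw : 0 < w.re) :
    HasDerivAt macdonaldSeries (eulerMacdonaldSeries w / w) w := by
  have hw₀ : w ≠ 0 := fun h => by simp [h] at hw
  refine (((hasDerivAt_neg_log_half_add hw _).mul
    (isBesselCoeff_one.hasDerivAt_modifiedSeries hw₀)).add
    (isBesselCoeff_harmonicCoeff.hasDerivAt_modifiedSeries hw₀)).congr_deriv ?_
  rw [eulerMacdonaldSeries]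
  field_simp
  ring

theorem hasDerivAt_eulerMacdonaldSeries {w : ℂ} (hw : 0 < w.re) :
    HasDerivAt eulerMacdonaldSeries (w * macdonaldSeries w) w := by
  have hw₀ : w ≠ 0 := fun h => by simp [h] at hw
  refine ((((hasDerivAt_neg_log_half_add hw _).mul
    (isBesselCoeff_one.hasDerivAt_eulerModifiedSeries w)).sub
    (isBesselCoeff_one.hasDerivAt_modifiedSeries hw₀)).add
    (isBesselCoeff_harmonicCoeff.hasDerivAt_eulerModifiedSeries w)).congr_deriv ?_
  rw [modifiedSeries_harmonicCoeff_succ, macdonaldSeries]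
  simp only [eulerModifiedSeries, Pi.one_apply, ← Pi.one_def]
  field_simp
  ring

theorem tendsto_log_mul_sub {f : ℂ → ℂ} (hf : DifferentiableAt ℂ f 0) (a : ℂ) :
    Tendsto (fun r : ℝ => (Real.log r + a) * (f r - f 0)) (𝓝[>] 0) (𝓝 0) := by
  have hf' : DifferentiableAt ℝ (fun r : ℝ => f r) 0 := by
    have := (Complex.ofReal_zero ▸ hf).hasDerivAt.comp_ofReal (z := 0)
    exact this.differentiableAt
  have hf₀ := ((tendsto_ofReal_nhdsGT_zero hf.continuousAt).sub_const (f 0)).const_mul a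
  simpa [add_mul] using (tendsto_log_smul_sub hf').add hf₀

theorem log_ofReal_div_two {r : ℝ} (hr : 0 < r) :
    Complex.log (r / 2) = Real.log r + -(Real.log 2 : ℂ) := by
  rw [show (r : ℂ) / 2 = (r / 2 : ℝ) by push_cast; rfl, ← Complex.ofReal_log (half_pos hr).le,
    Real.log_div hr.ne' two_ne_zero, Complex.ofReal_sub, sub_eq_add_neg]

theorem tendsto_macdonald_sub_series :
    Tendsto (fun r : ℝ => macdonald r - macdonaldSeries r) (𝓝[>] 0) (𝓝 0) := by
  have hI := tendsto_log_mul_sub (isBesselCoeff_one.differentiable_modifiedSeries 0)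
    (-(Real.log 2 : ℂ) + Real.eulerMascheroniConstant)
  have hS := tendsto_ofReal_nhdsGT_zero
    (isBesselCoeff_harmonicCoeff.differentiable_modifiedSeries 0).continuousAt
  have h := ((tendsto_macdonald_add_log.add_const (Real.eulerMascheroniConstant : ℂ)).add hI).sub hS
  rw [neg_add_cancel, zero_add, modifiedSeries_zero, modifiedSeries_zero, harmonicCoeff,
    harmonic_zero, Rat.cast_zero, sub_zero] at h
  refine h.congr' ?_
  filter_upwards [self_mem_nhdsWithin] with r hr
  rw [macdonaldSeries, log_ofReal_div_two hr, Pi.one_apply, Real.log_div (ne_of_gt hr) two_ne_zero,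
    Complex.ofReal_sub]
  ring

theorem tendsto_euler_macdonald_sub_series :
    Tendsto (fun r : ℝ => -(r * macdonaldMoment 1 r) - eulerMacdonaldSeries r) (𝓝[>] 0)
      (𝓝 0) := by
  have hQ := tendsto_log_mul_sub
    (isBesselCoeff_one.hasDerivAt_eulerModifiedSeries 0).differentiableAt
    (-(Real.log 2 : ℂ) + Real.eulerMascheroniConstant)
  have hI := tendsto_ofReal_nhdsGT_zero
    (isBesselCoeff_one.differentiable_modifiedSeries 0).continuousAt
  have hS := tendsto_ofReal_nhdsGT_zero
    (isBesselCoeff_harmonicCoeff.hasDerivAt_eulerModifiedSeries 0).continuousAt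
  have h := ((tendsto_mul_macdonaldMoment_one.neg.add hI).add hQ).sub hS
  simp only [modifiedSeries_zero, eulerModifiedSeries_zero, Pi.one_apply, neg_add_cancel, add_zero,
    sub_zero] at h
  refine h.congr' ?_
  filter_upwards [self_mem_nhdsWithin] with r hr
  rw [eulerMacdonaldSeries, log_ofReal_div_two hr]
  ring

theorem macdonald_ofReal {r : ℝ} (hr : 0 < r) : macdonald r = macdonaldSeries r := by
  refine sub_eq_zero.mp (eq_zero_of_modifiedBessel (fun r hr => ?_) (fun r hr => ?_)
    tendsto_macdonald_sub_series tendsto_euler_macdonald_sub_series hr)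
  · have hr' : (r : ℂ) ≠ 0 := mod_cast hr.ne'
    refine ((hasDerivAt_macdonald (w := r) hr).sub
      (hasDerivAt_macdonaldSeries hr)).comp_ofReal.congr_deriv ?_
    field_simp
  · refine ((((hasDerivAt_id (r : ℂ)).mul (hasDerivAt_macdonaldMoment 1 (w := r) hr)).neg).sub
      (hasDerivAt_eulerMacdonaldSeries hr)).comp_ofReal.congr_deriv ?_
    rw [mul_sub, macdonald, ← macdonaldMoment_ode (w := r) hr]
    simp only [id_eq]
    ring

theorem eqOn_re_pos_of_eqOn_ofReal {f g : ℂ → ℂ} (hf : DifferentiableOn ℂ f {w | 0 < w.re})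
    (hg : DifferentiableOn ℂ g {w | 0 < w.re}) (h : ∀ r : ℝ, 0 < r → f r = g r) :
    EqOn f g {w | 0 < w.re} := by
  have hU : IsOpen {w : ℂ | 0 < w.re} := isOpen_lt continuous_const Complex.continuous_re
  have hofReal : Tendsto (fun r : ℝ => (r : ℂ)) (𝓝[>] 1) (𝓝[≠] 1) :=
    tendsto_nhdsWithin_iff.mpr
      ⟨(Complex.continuous_ofReal.tendsto' 1 1 Complex.ofReal_one).mono_left nhdsWithin_le_nhds,
        eventually_mem_nhdsWithin.mono fun r (hr : 1 < r) =>
          Complex.ofReal_ne_one.mpr hr.ne'⟩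
  refine (hf.analyticOnNhd hU).eqOn_of_preconnected_of_frequently_eq (hg.analyticOnNhd hU)
    (convex_halfSpace_re_gt 0).isPreconnected (z₀ := 1) (by simp) (hofReal.frequently ?_)
  exact (eventually_mem_nhdsWithin.mono fun r (hr : r ∈ Ioi 1) =>
    h r (zero_lt_one.trans hr)).frequently

theorem macdonald_eq_series {w : ℂ} (hw : 0 < w.re) : macdonald w = macdonaldSeries w :=
  eqOn_re_pos_of_eqOn_ofReal
    (fun _ hw => (hasDerivAt_macdonald hw).differentiableAt.differentiableWithinAt)
    (fun _ hw => (hasDerivAt_macdonaldSeries hw).differentiableAt.differentiableWithinAt)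
    (fun _ hr => macdonald_ofReal hr) hw

theorem log_neg_I_mul {w : ℂ} (hw : 0 < w.im) :
    Complex.log (-Complex.I * w) = Complex.log w - Real.pi / 2 * Complex.I := by
  have hw₀ : w ≠ 0 := fun h => by simp [h] at hw
  have harg : 0 ≤ w.arg := Complex.arg_nonneg_iff.mpr hw.le
  rw [(Complex.log_mul_eq_add_log_iff (by simp) hw₀).mpr, Complex.log_neg_I]
  · ring
  · rw [Complex.arg_neg_I]
    constructor <;> linarith [Real.pi_pos, Complex.arg_le_pi w]

theorem hankel_eq_macdonald {w : ℂ} (hw : 0 < w.im) :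
    Complex.I / 4 * hankel w = 1 / (2 * Real.pi) * macdonald (-Complex.I * w) := by
  have hπ : (Real.pi : ℂ) ≠ 0 := mod_cast Real.pi_ne_zero
  have hre : 0 < (-Complex.I * w).re := by simpa
  have hlog : Complex.log (-Complex.I * w / 2) =
      Complex.log (w / 2) - Real.pi / 2 * Complex.I := by
    rw [mul_div_assoc, log_neg_I_mul (by simpa using hw)]
  have hsq : (-Complex.I * w) ^ 2 / 4 = -(w ^ 2 / 4) := by
    rw [mul_pow, neg_sq, Complex.I_sq]
    ring
  rw [macdonald_eq_series hre, macdonaldSeries, hlog, modifiedSeries, modifiedSeries, hsq, hankel,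
    besselJ0_eq_besselSeries, besselY0_eq_besselSeries]
  field_simp
  ring_nf
  simp only [Complex.I_sq]
  ring

/-! ### The fundamental solution and its Fourier transform -/

/-- The fundamental solution `(2π)⁻¹ K₀(κ|y|)` of `-Δ + κ²` in the plane. -/
def green (κ : ℂ) (y : Plane) : ℂ := 1 / (2 * Real.pi) * macdonald (κ * ‖y‖)

/-- The integrand of the heat kernel representation of `green κ`; the time variable is `eᵗ / κ`. -/
def heatKernel (κ : ℂ) (y : Plane) (t : ℝ) : ℂ := 1 / (4 * Real.pi) *
  (Complex.exp (-κ * Real.exp t) * Complex.exp (-(κ * Real.exp (-t) / 4) * ‖y‖ ^ 2))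

theorem re_mul_ofReal_pos {κ : ℂ} (hκ : 0 < κ.re) {r : ℝ} (hr : 0 < r) : 0 < (κ * r).re := by
  simpa using mul_pos hκ hr

theorem integral_cexp_neg_mul_cosh {w : ℂ} (hw : 0 < w.re) :
    ∫ t : ℝ, Complex.exp (-w * Real.cosh t) = 2 * macdonald w := by
  have hi : Integrable fun t : ℝ => Complex.exp (-w * Real.cosh t) := by
    simpa using integrable_cosh_pow_mul_cexp 0 hw
  have h := integral_comp_neg_Ioi (c := 0) (fun t : ℝ => Complex.exp (-w * Real.cosh t))
  simp only [Real.cosh_neg, neg_zero] at h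
  rw [← intervalIntegral.integral_Iic_add_Ioi hi.integrableOn hi.integrableOn (b := 0), ← h,
    macdonald, macdonaldMoment]
  simp only [pow_zero, one_mul]
  ring

theorem green_eq_integral_heatKernel {κ : ℂ} (hκ : 0 < κ.re) {y : Plane} (hy : y ≠ 0) :
    green κ y = ∫ t : ℝ, heatKernel κ y t := by
  have hy' : 0 < ‖y‖ := norm_pos_iff.mpr hy
  have hy'' : (‖y‖ : ℂ) ≠ 0 := mod_cast hy'.ne'
  -- the translation `t ↦ t + log (|y| / 2)` symmetrises the exponent
  have hshift (t : ℝ) : Complex.exp (-κ * Real.exp (t + Real.log (‖y‖ / 2))) *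
      Complex.exp (-(κ * Real.exp (-(t + Real.log (‖y‖ / 2))) / 4) * ‖y‖ ^ 2) =
        Complex.exp (-(κ * ‖y‖) * Real.cosh t) := by
    rw [← Complex.exp_add, neg_add, Real.exp_add, Real.exp_add, Real.exp_neg (Real.log _),
      Real.exp_log (by positivity), Real.cosh_eq]
    congr 1
    push_cast
    field_simp
    ring
  simp only [heatKernel]
  rw [integral_const_mul, ← integral_add_right_eq_self _ (Real.log (‖y‖ / 2))]
  simp only [hshift]
  rw [integral_cexp_neg_mul_cosh (re_mul_ofReal_pos hκ hy'), green]
  ring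

theorem green_ae_eq_integral_heatKernel {κ : ℂ} (hκ : 0 < κ.re) :
    green κ =ᵐ[volume] fun y => ∫ t : ℝ, heatKernel κ y t := by
  filter_upwards [compl_mem_ae_iff.mpr (measure_singleton (0 : Plane))] with y hy
  exact green_eq_integral_heatKernel hκ hy

theorem integrable_exp_mul_cexp_neg_mul_exp {b : ℂ} (hb : 0 < b.re) :
    Integrable fun t : ℝ => (Real.exp t : ℂ) * Complex.exp (-b * Real.exp t) := by
  have h := integrableOn_exp_mul_complex_Ioi (a := -b) (by simpa) 0
  rw [← Real.range_exp, ← image_univ, integrableOn_image_iff_integrableOn_abs_deriv_smul .univ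
    (fun t _ => (Real.hasDerivAt_exp t).hasDerivWithinAt) Real.exp_injective.injOn] at h
  simpa only [integrableOn_univ, Real.abs_exp, Complex.real_smul] using h

theorem integral_exp_mul_cexp_neg_mul_exp {b : ℂ} (hb : 0 < b.re) :
    ∫ t : ℝ, (Real.exp t : ℂ) * Complex.exp (-b * Real.exp t) = b⁻¹ := by
  have h := integral_exp_mul_complex_Ioi (a := -b) (by simpa) 0
  rw [← Real.range_exp, ← image_univ, integral_image_eq_integral_abs_deriv_smul .univ
    (fun t _ => (Real.hasDerivAt_exp t).hasDerivWithinAt) Real.exp_injective.injOn] at h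
  simpa [neg_div_neg_eq] using h

theorem fourier_heatKernel {κ : ℂ} (hκ : 0 < κ.re) (t : ℝ) (ξ : Plane) :
    FourierTransform.fourier (fun y => heatKernel κ y t) ξ =
      κ⁻¹ * (Real.exp t * Complex.exp (-(κ + (2 * Real.pi) ^ 2 * ‖ξ‖ ^ 2 / κ) * Real.exp t)) := by
  have hκ₀ : κ ≠ 0 := fun h => by simp [h] at hκ
  have hπ : (Real.pi : ℂ) ≠ 0 := mod_cast Real.pi_ne_zero
  have hexp : (Real.exp t : ℂ) ≠ 0 := mod_cast (Real.exp_pos t).ne'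
  have hexp_neg : (Real.exp (-t) : ℂ) = (Real.exp t : ℂ)⁻¹ := by
    rw [Real.exp_neg, Complex.ofReal_inv]
  have hb : 0 < (κ * Real.exp (-t) / 4).re := by
    rw [mul_div_assoc, show (Real.exp (-t) : ℂ) / 4 = (Real.exp (-t) / 4 : ℝ) by push_cast; rfl]
    exact re_mul_ofReal_pos hκ (by positivity)
  have hconst (y : Plane) : Real.fourierChar (-inner ℝ y ξ) • heatKernel κ y t =
      (1 / (4 * Real.pi) * Complex.exp (-κ * Real.exp t)) *
        Real.fourierChar (-inner ℝ y ξ) • Complex.exp (-(κ * Real.exp (-t) / 4) * ‖y‖ ^ 2) := by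
    rw [mul_smul_comm, heatKernel, mul_assoc]
  have hgauss := fourier_gaussian_innerProductSpace hb ξ
  rw [Real.fourier_eq, finrank_euclideanSpace_fin, Nat.cast_ofNat, div_self two_ne_zero,
    Complex.cpow_one, hexp_neg] at hgauss
  have hexponent : -(Real.pi : ℂ) ^ 2 * ‖ξ‖ ^ 2 / (κ * (Real.exp t : ℂ)⁻¹ / 4) =
      -((2 * Real.pi) ^ 2 * ‖ξ‖ ^ 2 / κ) * Real.exp t := by
    field_simp
    ring
  simp only [Real.fourier_eq, hconst]
  rw [integral_const_mul, hexp_neg, hgauss, hexponent, neg_add, add_mul, Complex.exp_add]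
  field_simp

theorem continuous_uncurry_heatKernel (κ : ℂ) : Continuous (Function.uncurry (heatKernel κ)) := by
  unfold Function.uncurry heatKernel
  fun_prop

theorem norm_heatKernel (κ : ℂ) (y : Plane) (t : ℝ) : ‖heatKernel κ y t‖ =
    1 / (4 * Real.pi) * Real.exp (-κ.re * Real.exp t) *
      Real.exp (-(κ.re * Real.exp (-t) / 4) * ‖y‖ ^ 2) := by
  have hexponent : -(κ * Real.exp (-t) / 4) * (‖y‖ : ℂ) ^ 2 =
      κ * ((-(Real.exp (-t) / 4 * ‖y‖ ^ 2) : ℝ) : ℂ) := by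
    push_cast
    ring
  rw [heatKernel, norm_mul, norm_mul, Complex.norm_exp, Complex.norm_exp, hexponent,
    Complex.re_mul_ofReal, Complex.re_mul_ofReal, Complex.neg_re, ← mul_assoc]
  congr 2
  · rw [norm_div, norm_mul, Complex.norm_real, Real.norm_of_nonneg Real.pi_pos.le]
    simp
  · ring

theorem integrable_exp_neg_mul_norm_sq {V : Type*} [NormedAddCommGroup V] [InnerProductSpace ℝ V]
    [FiniteDimensional ℝ V] [MeasurableSpace V] [BorelSpace V] {b : ℝ} (hb : 0 < b) :
    Integrable fun y : V => Real.exp (-b * ‖y‖ ^ 2) := by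
  have h := GaussianFourier.integrable_cexp_neg_mul_sq_norm_add (V := V) (b := b) hb 0 0
  refine h.norm.congr (ae_of_all _ fun y => ?_)
  simp only [Complex.norm_exp, zero_mul, add_zero]
  norm_cast

theorem integral_norm_heatKernel {κ : ℂ} (hκ : 0 < κ.re) (t : ℝ) :
    ∫ y, ‖heatKernel κ y t‖ = κ.re⁻¹ * (Real.exp t * Real.exp (-κ.re * Real.exp t)) := by
  simp only [norm_heatKernel]
  rw [integral_const_mul, GaussianFourier.integral_rexp_neg_mul_sq_norm (by positivity),
    finrank_euclideanSpace_fin, Nat.cast_ofNat, div_self two_ne_zero, Real.rpow_one, Real.exp_neg]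
  field_simp

theorem integrable_heatKernel {κ : ℂ} (hκ : 0 < κ.re) :
    Integrable (Function.uncurry (heatKernel κ)) (volume.prod volume) := by
  have hcont := continuous_uncurry_heatKernel κ
  rw [integrable_prod_iff' hcont.aestronglyMeasurable]
  refine ⟨ae_of_all _ fun t => ?_, ?_⟩
  · refine ((integrable_exp_neg_mul_norm_sq (by positivity)).const_mul _).mono'
      (hcont.comp (by fun_prop : Continuous fun y : Plane => (y, t))).aestronglyMeasurable
      (ae_of_all _ fun y => (norm_heatKernel κ y t).le)
  · simp only [Function.uncurry_apply_pair, integral_norm_heatKernel hκ]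
    refine ((integrable_exp_mul_cexp_neg_mul_exp hκ).norm.const_mul κ.re⁻¹).congr
      (ae_of_all _ fun t => ?_)
    simp only [norm_mul, Complex.norm_real, Complex.norm_exp, Complex.re_mul_ofReal, Complex.neg_re,
      Real.norm_of_nonneg (Real.exp_pos t).le]

theorem integrable_green {κ : ℂ} (hκ : 0 < κ.re) : Integrable (green κ) :=
  (integrable_heatKernel hκ).integral_prod_left.congr (green_ae_eq_integral_heatKernel hκ).symm

theorem fourier_integral_eq_integral_fourier {V T E : Type*} [NormedAddCommGroup V]
    [InnerProductSpace ℝ V] [MeasurableSpace V] [BorelSpace V] [FiniteDimensional ℝ V]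
    [MeasurableSpace T] {μ : Measure T} [SFinite μ] [NormedAddCommGroup E] [NormedSpace ℂ E]
    {f : V → T → E} (hf : Integrable (Function.uncurry f) (volume.prod μ)) (ξ : V) :
    FourierTransform.fourier (fun y => ∫ t, f y t ∂μ) ξ =
      ∫ t, FourierTransform.fourier (fun y => f y t) ξ ∂μ := by
  have hchar : Measurable fun p : V × T => (Real.fourierChar (-inner ℝ p.1 ξ) : ℂ) :=
    (continuous_subtype_val.comp (Real.continuous_fourierChar.comp
      (by fun_prop : Continuous fun y : V => -inner ℝ y ξ))).measurable.comp measurable_fst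
  simp only [Real.fourier_eq, Circle.smul_def, ← integral_smul]
  refine integral_integral_swap (hf.bdd_smul 1 hchar.aestronglyMeasurable ?_)
  exact ae_of_all _ fun p => (Circle.norm_coe _).le

theorem fourier_green {κ : ℂ} (hκ : 0 < κ.re) (ξ : Plane) :
    FourierTransform.fourier (green κ) ξ = ((2 * Real.pi) ^ 2 * ‖ξ‖ ^ 2 + κ ^ 2)⁻¹ := by
  have hκ₀ : κ ≠ 0 := fun h => by simp [h] at hκ
  have hre : 0 < (κ + (2 * Real.pi) ^ 2 * ‖ξ‖ ^ 2 / κ).re := by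
    rw [div_eq_inv_mul, show (2 * Real.pi : ℂ) ^ 2 * ‖ξ‖ ^ 2 = ((2 * Real.pi) ^ 2 * ‖ξ‖ ^ 2 : ℝ) by
      push_cast; rfl, Complex.add_re, Complex.re_mul_ofReal, Complex.inv_re]
    have : 0 < Complex.normSq κ := Complex.normSq_pos.mpr hκ₀
    positivity
  rw [Real.fourier_congr_ae (green_ae_eq_integral_heatKernel hκ),
    fourier_integral_eq_integral_fourier (integrable_heatKernel hκ)]
  simp only [fourier_heatKernel hκ]
  rw [integral_const_mul, integral_exp_mul_cexp_neg_mul_exp hre, ← mul_inv]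
  congr 1
  field_simp
  ring

theorem continuousOn_green {κ : ℂ} (hκ : 0 < κ.re) : ContinuousOn (green κ) {0}ᶜ := by
  intro y hy
  have hK : ContinuousAt macdonald (κ * ‖y‖) :=
    (hasDerivAt_macdonald (re_mul_ofReal_pos hκ (norm_pos_iff.mpr hy))).continuousAt
  exact (continuousAt_const.mul (hK.comp' (f := fun y : Plane => κ * (‖y‖ : ℂ))
    (by fun_prop))).continuousWithinAt

/-- The constant term of `green κ` at `0`. -/
def greenConst (κ : ℂ) : ℂ :=
  -(1 / (2 * Real.pi)) * (Complex.log (κ / 2) + Real.eulerMascheroniConstant)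

theorem tendsto_macdonald_ofReal_add_log {κ : ℂ} (hκ : 0 < κ.re) :
    Tendsto (fun r : ℝ => macdonald (κ * r) + (Real.log r : ℂ)) (𝓝[>] 0)
      (𝓝 (-(Complex.log (κ / 2) + Real.eulerMascheroniConstant))) := by
  have hκ₀ : κ ≠ 0 := fun h => by simp [h] at hκ
  have hdiff {c : ℕ → ℂ} (hc : IsBesselCoeff c) :
      DifferentiableAt ℂ (fun w => modifiedSeries c (κ * w)) 0 :=
    (hc.differentiable_modifiedSeries.comp (differentiable_id.const_mul κ)).differentiableAt
  have hI := tendsto_log_mul_sub (hdiff isBesselCoeff_one)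
    (Complex.log (κ / 2) + Real.eulerMascheroniConstant)
  have hS := tendsto_ofReal_nhdsGT_zero (hdiff isBesselCoeff_harmonicCoeff).continuousAt
  have h := (hS.sub hI).sub_const (Complex.log (κ / 2) + Real.eulerMascheroniConstant)
  simp only [mul_zero, modifiedSeries_zero, harmonicCoeff, harmonic_zero, Rat.cast_zero, sub_zero,
    zero_sub, Pi.one_apply] at h
  refine h.congr' ?_
  filter_upwards [eventually_mem_nhdsWithin] with r hr
  have hlog : Complex.log (κ * r / 2) = Real.log r + Complex.log (κ / 2) := by
    rw [← Complex.log_mul_ofReal r hr (κ / 2) (by simpa), mul_div_right_comm]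
  rw [macdonald_eq_series (re_mul_ofReal_pos hκ hr), macdonaldSeries, hlog]
  ring

theorem tendsto_green_add_log {κ : ℂ} (hκ : 0 < κ.re) :
    Tendsto (fun y => green κ y + 1 / (2 * Real.pi) * (Real.log ‖y‖ : ℂ)) (𝓝[≠] 0)
      (𝓝 (greenConst κ)) := by
  have h := ((tendsto_macdonald_ofReal_add_log hκ).comp
    (tendsto_norm_nhdsNE_zero (E := Plane))).const_mul (1 / (2 * Real.pi : ℂ))
  rw [greenConst, neg_mul_comm]
  refine h.congr fun y => ?_
  simp only [Function.comp, green]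
  ring

theorem conj_macdonald (w : ℂ) :
    (starRingEnd ℂ) (macdonald w) = macdonald ((starRingEnd ℂ) w) := by
  simp only [macdonald, macdonaldMoment, ← integral_conj, map_mul, map_pow, ← Complex.exp_conj,
    map_neg, Complex.conj_ofReal]

theorem conj_greenConst {κ : ℂ} (hκ : 0 < κ.re) :
    (starRingEnd ℂ) (greenConst κ) = greenConst ((starRingEnd ℂ) κ) := by
  have harg : (κ / 2).arg ≠ Real.pi :=
    Complex.mem_slitPlane_iff_arg.mp (Or.inl (by simpa using hκ)) |>.1
  have hlog := Complex.log_conj _ harg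
  simp only [map_div₀, map_ofNat] at hlog
  simp [greenConst, hlog, Complex.conj_ofReal, Complex.conj_ofNat]

/-! ### The Fourier transform on `L¹` and on `L²` -/

section Fourier

open FourierTransform
open scoped ENNReal

section Distribution

variable {V F : Type*} [NormedAddCommGroup V] [NormedSpace ℝ V] [FiniteDimensional ℝ V]
  [MeasurableSpace V] [BorelSpace V] [NormedAddCommGroup F] [NormedSpace ℂ F] [CompleteSpace F]
  {μ : Measure V} [μ.HasTemperateGrowth] [IsLocallyFiniteMeasure μ] {p : ℝ≥0∞} [Fact (1 ≤ p)]

theorem ae_eq_of_toTemperedDistribution_eq_integral {f : Lp F p μ} {a : V → F}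
    (ha : LocallyIntegrable a μ)
    (h : ∀ ψ : 𝓢(V, ℂ), Lp.toTemperedDistribution f ψ = ∫ y, ψ y • a y ∂μ) : f =ᵐ[μ] a := by
  refine ae_eq_of_integral_contDiff_smul_eq ((Lp.memLp f).locallyIntegrable Fact.out) ha ?_
  intro g hg hgc
  have hgc' : HasCompactSupport (Complex.ofRealCLM ∘ g) := hgc.comp_left rfl
  have hg' : ContDiff ℝ _ (Complex.ofRealCLM ∘ g) := Complex.ofRealCLM.contDiff.comp hg
  have hψ := h (hgc'.toSchwartzMap hg')
  rw [Lp.toTemperedDistribution_apply] at hψ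
  simpa using hψ

theorem smulLeftCLM_toTemperedDistribution_eq_iff {σ : V → ℂ} (hσ : σ.HasTemperateGrowth)
    (f g : Lp F p μ) :
    TemperedDistribution.smulLeftCLM F σ (Lp.toTemperedDistribution f) =
      Lp.toTemperedDistribution g ↔ g =ᵐ[μ] fun ξ => σ ξ • f ξ := by
  have hsmul (ψ : 𝓢(V, ℂ)) :
      TemperedDistribution.smulLeftCLM F σ (Lp.toTemperedDistribution f) ψ =
        ∫ ξ, ψ ξ • σ ξ • f ξ ∂μ := by
    rw [TemperedDistribution.smulLeftCLM_apply_apply, Lp.toTemperedDistribution_apply]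
    simp only [SchwartzMap.smulLeftCLM_apply_apply hσ, smul_smul, smul_eq_mul, mul_comm]
  constructor
  · intro h
    refine ae_eq_of_toTemperedDistribution_eq_integral ?_ fun ψ => by rw [← hsmul, h]
    exact ((Lp.memLp f).locallyIntegrable Fact.out).continuous_smul hσ.1.continuous
  · intro h
    ext1 ψ
    rw [hsmul, Lp.toTemperedDistribution_apply]
    refine integral_congr_ae ?_
    filter_upwards [h] with ξ hξ
    rw [hξ]

end Distribution

theorem continuous_neg_innerₗ {V : Type*} [NormedAddCommGroup V] [InnerProductSpace ℝ V] :
    Continuous fun p : V × V => (-innerₗ V) p.1 p.2 := by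
  simp only [LinearMap.neg_apply, innerₗ_apply_apply]
  fun_prop

variable {V F : Type*} [NormedAddCommGroup V] [InnerProductSpace ℝ V] [FiniteDimensional ℝ V]
  [MeasurableSpace V] [BorelSpace V] [NormedAddCommGroup F]

theorem continuous_fourierInv_of_integrable [NormedSpace ℂ F] {a : V → F} (ha : Integrable a) :
    Continuous (𝓕⁻ a) :=
  VectorFourier.fourierIntegral_continuous Real.continuous_fourierChar continuous_neg_innerₗ ha

variable [InnerProductSpace ℂ F] [CompleteSpace F]

theorem inner_fourierInv_eq_integral {a : V → F} (ha : Integrable a)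
    (y : V) (c : F) :
    inner ℂ c (𝓕⁻ a y) = ∫ ξ, inner ℂ ((Real.fourierChar (-inner ℝ y ξ) : ℂ) • c) (a ξ) := by
  have hcont : Continuous fun ξ : V => Real.fourierChar (inner ℝ ξ y) :=
    Real.continuous_fourierChar.comp (by fun_prop)
  have hint : Integrable fun ξ => Real.fourierChar (inner ℝ ξ y) • a ξ :=
    ha.norm.mono' (hcont.aestronglyMeasurable.smul ha.1) (ae_of_all _ fun ξ => by
      rw [Circle.norm_smul])
  rw [Real.fourierInv_eq, ← integral_inner hint]
  refine integral_congr_ae (ae_of_all _ fun ξ => ?_)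
  simp only [Circle.smul_def, inner_smul_left, inner_smul_right, real_inner_comm ξ y,
    AddChar.map_neg_eq_inv, Circle.coe_inv_eq_conj, Complex.conj_conj]

theorem fourierInv_toLp_fourier_ae_eq {a : V → F} (ha : Integrable a) (hb : MemLp (𝓕 a) 2) :
    (𝓕⁻ (hb.toLp (𝓕 a)) : Lp F 2 (volume : Measure V)) =ᵐ[volume] a := by
  refine ae_eq_of_toTemperedDistribution_eq_integral ha.locallyIntegrable fun ψ => ?_
  rw [← Lp.fourierInv_toTemperedDistribution_eq, TemperedDistribution.fourierInv_apply,
    Lp.toTemperedDistribution_apply]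
  have hflip := VectorFourier.integral_fourierIntegral_smul_eq_flip (e := Real.fourierChar)
    (L := innerₗ V) (f := (𝓕⁻ ψ : 𝓢(V, ℂ))) (g := a) (μ := volume) (ν := volume)
    Real.continuous_fourierChar continuous_inner (𝓕⁻ ψ : 𝓢(V, ℂ)).integrable ha
  rw [flip_innerₗ] at hflip
  calc ∫ y, (𝓕⁻ ψ : 𝓢(V, ℂ)) y • hb.toLp (𝓕 a) y = ∫ y, (𝓕⁻ ψ : 𝓢(V, ℂ)) y • 𝓕 a y := by
        refine integral_congr_ae ?_
        filter_upwards [hb.coeFn_toLp] with y hy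
        rw [hy]
    _ = ∫ y, 𝓕 (𝓕⁻ ψ : 𝓢(V, ℂ)) y • a y := hflip.symm
    _ = ∫ y, ψ y • a y := by
        rw [FourierTransform.fourier_fourierInv_eq]

theorem memLp_two_of_memLp_fourier {a : V → F} (ha : Integrable a) (hb : MemLp (𝓕 a) 2) :
    MemLp a 2 :=
  (memLp_congr_ae (fourierInv_toLp_fourier_ae_eq ha hb)).mp (Lp.memLp _)

theorem fourier_ae_eq_of_ae_eq {f : Lp F 2 (volume : Measure V)} {a : V → F}
    (ha : Integrable a) (hb : MemLp (𝓕 a) 2) (h : f =ᵐ[volume] a) :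
    (𝓕 f : Lp F 2 (volume : Measure V)) =ᵐ[volume] 𝓕 a := by
  have hf : f = 𝓕⁻ (hb.toLp (𝓕 a)) := Lp.ext (h.trans (fourierInv_toLp_fourier_ae_eq ha hb).symm)
  rw [hf, FourierTransform.fourier_fourierInv_eq]
  exact hb.coeFn_toLp

theorem fourierInv_ae_eq_fourierInv {b : Lp F 2 (volume : Measure V)} (hb : Integrable b) :
    (𝓕⁻ b : Lp F 2 (volume : Measure V)) =ᵐ[volume] 𝓕⁻ (b : V → F) := by
  refine ae_eq_of_toTemperedDistribution_eq_integral
    (continuous_fourierInv_of_integrable hb).locallyIntegrable fun ψ => ?_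
  rw [← Lp.fourierInv_toTemperedDistribution_eq, TemperedDistribution.fourierInv_apply,
    Lp.toTemperedDistribution_apply, SchwartzMap.fourierInv_coe]
  have hflip := VectorFourier.integral_fourierIntegral_smul_eq_flip (e := Real.fourierChar)
    (L := -innerₗ V) (f := ψ) (g := b) (μ := volume) (ν := volume)
    Real.continuous_fourierChar continuous_neg_innerₗ ψ.integrable hb
  have hneg : (-innerₗ V).flip = -innerₗ V := by
    ext x y
    simp [real_inner_comm]
  rwa [hneg] at hflip

/-- The operator on `L²` that multiplies the Fourier transform by the bounded function `σ`. -/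
def fourierMultiplier {σ : V → ℂ} (hσ : MemLp σ ∞) :
    Lp F 2 (volume : Measure V) →L[ℂ] Lp F 2 (volume : Measure V) :=
  fourierInvCLM ℂ _ ∘L (ContinuousLinearMap.lsmul ℂ ℂ).holderL volume ∞ 2 2 (hσ.toLp σ) ∘L
    fourierCLM ℂ (Lp F 2 (volume : Measure V))

theorem fourier_fourierMultiplier_ae_eq {σ : V → ℂ} (hσ : MemLp σ ∞)
    (φ : Lp F 2 (volume : Measure V)) :
    (𝓕 (fourierMultiplier hσ φ) : Lp F 2 (volume : Measure V)) =ᵐ[volume]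
      fun ξ => σ ξ • (𝓕 φ : Lp F 2 (volume : Measure V)) ξ := by
  have h : (𝓕 (fourierMultiplier hσ φ) : Lp F 2 (volume : Measure V)) =
      (ContinuousLinearMap.lsmul ℂ ℂ).holder 2 (hσ.toLp σ) (𝓕 φ) :=
    FourierTransform.fourier_fourierInv_eq _
  rw [h]
  filter_upwards [(ContinuousLinearMap.lsmul ℂ ℂ).coeFn_holder (r := 2) (hσ.toLp σ)
    (𝓕 φ : Lp F 2 (volume : Measure V)), hσ.coeFn_toLp] with ξ hmul hσξ
  rw [hmul, hσξ, ContinuousLinearMap.lsmul_apply]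

theorem inner_fourierMultiplier {σ τ : V → ℂ} (hσ : MemLp σ ∞) (hτ : MemLp τ ∞)
    (hconj : ∀ ξ, τ ξ = (starRingEnd ℂ) (σ ξ)) (φ ψ : Lp F 2 (volume : Measure V)) :
    inner ℂ ψ (fourierMultiplier hσ φ) = inner ℂ (fourierMultiplier hτ ψ) φ := by
  rw [← Lp.inner_fourier_eq, ← Lp.inner_fourier_eq (fourierMultiplier hτ ψ), L2.inner_def,
    L2.inner_def]
  refine integral_congr_ae ?_
  filter_upwards [fourier_fourierMultiplier_ae_eq hσ φ, fourier_fourierMultiplier_ae_eq hτ ψ]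
    with ξ hφ hψ
  rw [hφ, hψ, inner_smul_left, inner_smul_right, hconj, Complex.conj_conj]

theorem fourier_sub_smul {a : V → ℂ} (y : V) (c : F) (ξ : V) :
    𝓕 (fun v => a (v - y) • c) ξ = ((Real.fourierChar (-inner ℝ y ξ) : ℂ) * 𝓕 a ξ) • c := by
  have htrans := congrFun (VectorFourier.fourierIntegral_comp_add_right Real.fourierChar volume
    (innerₗ V) a (-y)) ξ
  calc 𝓕 (fun v => a (v - y) • c) ξ = 𝓕 (a ∘ fun v => v + -y) ξ • c := by
        simp only [Real.fourier_eq, Circle.smul_def, smul_eq_mul, ← smul_smul,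
          ← integral_smul_const, Function.comp, sub_eq_add_neg]
    _ = _ := by
        rw [show 𝓕 (a ∘ fun v => v + -y) ξ = _ from htrans, innerₗ_apply_apply, inner_neg_left,
          Circle.smul_def, smul_eq_mul]
        rfl

end Fourier

/-! ### The free resolvent -/

section Resolvent

open FourierTransform
open scoped ENNReal

theorem mem_sobolev_iff {n : ℕ} (f : L2 n) :
    f ∈ sobolev n ↔ MemLp (fun ξ => ((1 + ‖ξ‖ ^ 2 : ℝ) : ℂ) • (𝓕 f : L2 n) ξ) 2 := by
  have hmem : f ∈ sobolev n ↔
      TemperedDistribution.MemSobolev 2 2 (Lp.toTemperedDistribution f) := Iff.rfl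
  have hσ : (fun ξ : Plane => (((1 + ‖ξ‖ ^ 2) ^ ((2 : ℝ) / 2) : ℝ) : ℂ)).HasTemperateGrowth := by
    fun_prop
  rw [hmem, TemperedDistribution.memSobolev_iff_exists_smulLeftCLM_fourier,
    Lp.fourier_toTemperedDistribution_eq]
  simp_rw [smulLeftCLM_toTemperedDistribution_eq_iff hσ, div_self (two_ne_zero' ℝ), Real.rpow_one]
  exact ⟨fun ⟨g, hg⟩ => (memLp_congr_ae hg).mp (Lp.memLp g), fun h => ⟨h.toLp _, h.coeFn_toLp⟩⟩

theorem fourier_laplacian {n : ℕ} (f : sobolev n) :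
    (𝓕 (laplacian n f) : L2 n) =ᵐ[volume]
      fun ξ => (-((2 * Real.pi) ^ 2 * ‖ξ‖ ^ 2) : ℂ) • (𝓕 (f : L2 n) : L2 n) ξ := by
  have hnorm : (fun ξ : Plane => ((‖ξ‖ ^ 2 : ℝ) : ℂ)).HasTemperateGrowth := by fun_prop
  have hconst : (fun _ : Plane => ((-(2 * Real.pi) ^ 2 : ℝ) : ℂ)).HasTemperateGrowth := by fun_prop
  have hmul : (fun ξ : Plane => (-((2 * Real.pi) ^ 2 * ‖ξ‖ ^ 2) : ℂ)) =
      (fun ξ : Plane => ((‖ξ‖ ^ 2 : ℝ) : ℂ)) * fun _ => ((-(2 * Real.pi) ^ 2 : ℝ) : ℂ) := by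
    funext ξ
    rw [Pi.mul_apply]
    push_cast
    ring
  have hΔ := toDistr_laplacian f
  rw [TemperedDistribution.laplacian_eq_fourierMultiplierCLM,
    TemperedDistribution.fourierMultiplierCLM_apply, ← Complex.coe_smul] at hΔ
  have hF (g : L2 n) : Lp.toTemperedDistribution (𝓕 g : L2 n) = 𝓕 (toDistr n g) :=
    (Lp.fourier_toTemperedDistribution_eq g).symm
  rw [← smulLeftCLM_toTemperedDistribution_eq_iff (hmul ▸ hnorm.mul hconst), hF, hF, hΔ, hmul,
    ← TemperedDistribution.smulLeftCLM_smulLeftCLM_apply hnorm hconst,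
    TemperedDistribution.smulLeftCLM_const, FourierTransform.fourier_smul,
    FourierTransform.fourier_fourierInv_eq]

section Symbol

variable {V : Type*} [NormedAddCommGroup V]

/-- The symbol of the resolvent `(-Δ + κ²)⁻¹`. -/
def resolventSymbol (κ : ℂ) (ξ : V) : ℂ := ((2 * Real.pi) ^ 2 * ‖ξ‖ ^ 2 + κ ^ 2)⁻¹

theorem one_add_norm_sq_le_mul_norm {κ : ℂ} (hκ : 0 < κ.re) {s : ℝ} (hs : 0 ≤ s) :
    1 + s ≤ (‖κ‖⁻¹ + ‖κ‖) / κ.re * ‖s + κ ^ 2‖ := by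
  have hκ₀ : κ ≠ 0 := fun h => by simp [h] at hκ
  have hre : (κ⁻¹ * s + κ).re = κ.re * (s / ‖κ‖ ^ 2 + 1) := by
    rw [Complex.add_re, Complex.re_mul_ofReal, Complex.inv_re, Complex.normSq_eq_norm_sq]
    field_simp
  have hle : κ.re * (s / ‖κ‖ ^ 2 + 1) ≤ ‖κ⁻¹ * s + κ‖ := hre ▸ Complex.re_le_norm _
  have hfactor : s + κ ^ 2 = κ * (κ⁻¹ * s + κ) := by field_simp
  calc 1 + s ≤ 1 + s + (s / ‖κ‖ ^ 2 + ‖κ‖ ^ 2) := le_add_of_nonneg_right (by positivity)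
    _ = (‖κ‖⁻¹ + ‖κ‖) / κ.re * (‖κ‖ * (κ.re * (s / ‖κ‖ ^ 2 + 1))) := by
        field_simp
        ring
    _ ≤ (‖κ‖⁻¹ + ‖κ‖) / κ.re * ‖s + κ ^ 2‖ := by
        rw [hfactor, norm_mul]
        gcongr

theorem resolventSymbol_denom_ne_zero {κ : ℂ} (hκ : 0 < κ.re) (ξ : V) :
    ((2 * Real.pi) ^ 2 * ‖ξ‖ ^ 2 + κ ^ 2 : ℂ) ≠ 0 := by
  intro h
  have hle := one_add_norm_sq_le_mul_norm hκ (s := (2 * Real.pi) ^ 2 * ‖ξ‖ ^ 2) (by positivity)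
  push_cast at hle
  rw [h, norm_zero, mul_zero] at hle
  nlinarith [sq_nonneg (2 * Real.pi * ‖ξ‖)]

theorem norm_resolventSymbol_le {κ : ℂ} (hκ : 0 < κ.re) (ξ : V) :
    ‖resolventSymbol κ ξ‖ ≤ (‖κ‖⁻¹ + ‖κ‖) / κ.re * (1 + ‖ξ‖ ^ 2)⁻¹ := by
  have hpos := norm_pos_iff.mpr (resolventSymbol_denom_ne_zero hκ ξ)
  have hle := one_add_norm_sq_le_mul_norm hκ (s := (2 * Real.pi) ^ 2 * ‖ξ‖ ^ 2) (by positivity)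
  push_cast at hle
  rw [resolventSymbol, norm_inv, ← div_eq_mul_inv, le_div_iff₀ (by positivity),
    inv_mul_le_iff₀ hpos, mul_comm]
  refine le_trans ?_ hle
  have hπ : 1 ≤ (2 * Real.pi) ^ 2 := by nlinarith [Real.pi_gt_three]
  gcongr
  exact le_mul_of_one_le_left (by positivity) hπ

theorem continuous_resolventSymbol {κ : ℂ} (hκ : 0 < κ.re) :
    Continuous (resolventSymbol κ : V → ℂ) :=
  Continuous.inv₀ (by fun_prop) (resolventSymbol_denom_ne_zero hκ)

theorem conj_resolventSymbol (κ : ℂ) (ξ : V) :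
    (starRingEnd ℂ) (resolventSymbol κ ξ) = resolventSymbol ((starRingEnd ℂ) κ) ξ := by
  simp [resolventSymbol, Complex.conj_ofReal, Complex.conj_ofNat]

variable [MeasurableSpace V] [BorelSpace V] {μ : Measure V}

theorem memLp_top_one_add_norm_sq_smul_resolventSymbol {κ : ℂ} (hκ : 0 < κ.re) :
    MemLp (fun ξ : V => ((1 + ‖ξ‖ ^ 2 : ℝ) : ℂ) * resolventSymbol κ ξ) ∞ μ := by
  have hcont : Continuous fun ξ : V => ((1 + ‖ξ‖ ^ 2 : ℝ) : ℂ) * resolventSymbol κ ξ :=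
    .mul (by fun_prop) (continuous_resolventSymbol hκ)
  refine memLp_top_of_bound hcont.aestronglyMeasurable ((‖κ‖⁻¹ + ‖κ‖) / κ.re)
    (ae_of_all _ fun ξ => ?_)
  have hpos : 0 < 1 + ‖ξ‖ ^ 2 := by positivity
  rw [norm_mul, Complex.norm_real, Real.norm_of_nonneg hpos.le, mul_comm]
  exact (le_mul_inv_iff₀ hpos).mp (norm_resolventSymbol_le hκ ξ)

theorem memLp_top_resolventSymbol {κ : ℂ} (hκ : 0 < κ.re) :
    MemLp (resolventSymbol κ : V → ℂ) ∞ μ := by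
  refine memLp_top_of_bound (continuous_resolventSymbol hκ).aestronglyMeasurable
    ((‖κ‖⁻¹ + ‖κ‖) / κ.re) (ae_of_all _ fun ξ => (norm_resolventSymbol_le hκ ξ).trans ?_)
  exact mul_le_of_le_one_right (by positivity)
    (inv_le_one_of_one_le₀ (le_add_of_nonneg_right (by positivity)))

theorem memLp_two_resolventSymbol [NormedSpace ℝ V] [FiniteDimensional ℝ V] [μ.IsAddHaarMeasure]
    (hdim : Module.finrank ℝ V < 4) {κ : ℂ} (hκ : 0 < κ.re) :
    MemLp (resolventSymbol κ : V → ℂ) 2 μ := by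
  have hcont : Continuous fun ξ : V => (1 + ‖ξ‖ ^ 2)⁻¹ :=
    Continuous.inv₀ (by fun_prop) fun ξ => by positivity
  have hweight : MemLp (fun ξ : V => (1 + ‖ξ‖ ^ 2)⁻¹) 2 μ := by
    rw [memLp_two_iff_integrable_sq hcont.aestronglyMeasurable]
    refine (integrable_rpow_neg_one_add_norm_sq (r := 4) (by exact_mod_cast hdim)).congr
      (ae_of_all _ fun ξ => ?_)
    have hpos : 0 < 1 + ‖ξ‖ ^ 2 := by positivity
    simp only
    rw [show (-4 / 2 : ℝ) = -((2 : ℕ) : ℝ) by norm_num, Real.rpow_neg hpos.le, Real.rpow_natCast,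
      inv_pow]
  refine hweight.of_le_mul (c := (‖κ‖⁻¹ + ‖κ‖) / κ.re)
    (continuous_resolventSymbol hκ).aestronglyMeasurable
    (ae_of_all _ fun ξ => (norm_resolventSymbol_le hκ ξ).trans_eq ?_)
  rw [Real.norm_of_nonneg (by positivity)]

end Symbol

variable {n : ℕ} {κ : ℂ}

variable (n) in
/-- The free resolvent `(-Δ + κ²)⁻¹ ⊗ I_n`. -/
def freeResolvent (hκ : 0 < κ.re) : L2 n →L[ℂ] L2 n :=
  fourierMultiplier (memLp_top_resolventSymbol hκ)

theorem fourier_freeResolvent_ae_eq (hκ : 0 < κ.re) (φ : L2 n) :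
    (𝓕 (freeResolvent n hκ φ) : L2 n) =ᵐ[volume]
      fun ξ => resolventSymbol κ ξ • (𝓕 φ : L2 n) ξ :=
  fourier_fourierMultiplier_ae_eq _ φ

theorem freeResolvent_mem_sobolev (hκ : 0 < κ.re) (φ : L2 n) :
    freeResolvent n hκ φ ∈ sobolev n := by
  rw [mem_sobolev_iff]
  refine (memLp_congr_ae ?_).mp ((Lp.memLp (𝓕 φ : L2 n)).smul
    (memLp_top_one_add_norm_sq_smul_resolventSymbol hκ))
  filter_upwards [fourier_freeResolvent_ae_eq hκ φ] with ξ h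
  rw [h, smul_smul]
  rfl

theorem fourier_neg_laplacian_add (κ : ℂ) (u : sobolev n) :
    (𝓕 (-laplacian n u + κ ^ 2 • (u : L2 n)) : L2 n) =ᵐ[volume]
      fun ξ => ((2 * Real.pi) ^ 2 * ‖ξ‖ ^ 2 + κ ^ 2 : ℂ) • (𝓕 (u : L2 n) : L2 n) ξ := by
  have hF : (𝓕 (-laplacian n u + κ ^ 2 • (u : L2 n)) : L2 n) =
      -𝓕 (laplacian n u) + κ ^ 2 • 𝓕 (u : L2 n) := by
    rw [FourierTransform.fourier_add, FourierTransform.fourier_smul]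
    congr 1
    exact map_neg (Lp.fourierTransformₗᵢ Plane (EuclideanSpace ℂ (Fin n))) _
  rw [hF]
  filter_upwards [Lp.coeFn_add (-𝓕 (laplacian n u) : L2 n) (κ ^ 2 • 𝓕 (u : L2 n)),
    Lp.coeFn_neg (𝓕 (laplacian n u) : L2 n), Lp.coeFn_smul (κ ^ 2) (𝓕 (u : L2 n) : L2 n),
    fourier_laplacian u] with ξ hadd hneg hsmul hΔ
  rw [hadd, Pi.add_apply, hneg, Pi.neg_apply, hsmul, Pi.smul_apply, hΔ, add_smul, neg_smul, neg_neg]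

theorem eq_of_fourier_ae_eq {f g : L2 n} (h : (𝓕 f : L2 n) =ᵐ[volume] (𝓕 g : L2 n)) : f = g :=
  (Lp.fourierTransformₗᵢ Plane (EuclideanSpace ℂ (Fin n))).injective (Lp.ext h)

theorem neg_laplacian_freeResolvent (hκ : 0 < κ.re) (φ : L2 n) :
    -laplacian n ⟨freeResolvent n hκ φ, freeResolvent_mem_sobolev hκ φ⟩ +
      κ ^ 2 • freeResolvent n hκ φ = φ := by
  apply eq_of_fourier_ae_eq
  filter_upwards [fourier_neg_laplacian_add κ ⟨_, freeResolvent_mem_sobolev hκ φ⟩,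
    fourier_freeResolvent_ae_eq hκ φ] with ξ hΔ hres
  rw [hΔ, hres, smul_smul, resolventSymbol, mul_inv_cancel₀ (resolventSymbol_denom_ne_zero hκ ξ),
    one_smul]

theorem freeResolvent_neg_laplacian (hκ : 0 < κ.re) (u : sobolev n) :
    freeResolvent n hκ (-laplacian n u + κ ^ 2 • (u : L2 n)) = u := by
  apply eq_of_fourier_ae_eq
  filter_upwards [fourier_neg_laplacian_add κ u,
    fourier_freeResolvent_ae_eq hκ (-laplacian n u + κ ^ 2 • (u : L2 n))] with ξ hΔ hres
  rw [hres, hΔ, smul_smul, resolventSymbol, inv_mul_cancel₀ (resolventSymbol_denom_ne_zero hκ ξ),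
    one_smul]

theorem inner_freeResolvent {κ' : ℂ} (hκ : 0 < κ.re) (hκ' : 0 < κ'.re)
    (hconj : κ' = (starRingEnd ℂ) κ) (φ ψ : L2 n) :
    inner ℂ ψ (freeResolvent n hκ φ) = inner ℂ (freeResolvent n hκ' ψ) φ :=
  inner_fourierMultiplier _ _ (fun ξ => by rw [conj_resolventSymbol, hconj]) φ ψ

/-! ### Point sources -/

theorem fourier_green_sub_smul (hκ : 0 < κ.re) (y : Plane) (c : EuclideanSpace ℂ (Fin n)) :
    𝓕 (fun v => green κ (v - y) • c) =
      fun ξ => ((Real.fourierChar (-inner ℝ y ξ) : ℂ) * resolventSymbol κ ξ) • c := by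
  funext ξ
  rw [fourier_sub_smul, fourier_green hκ, resolventSymbol]

theorem memLp_green (hκ : 0 < κ.re) : MemLp (green κ) 2 := by
  refine memLp_two_of_memLp_fourier (integrable_green hκ) ?_
  rw [show 𝓕 (green κ) = resolventSymbol κ from funext (fourier_green hκ)]
  exact memLp_two_resolventSymbol (by simp) hκ

variable (n) in
/-- The map `c ↦ green κ (· - y) c`, whose values are the solutions of `(-Δ + κ²) f = δ_y c`. -/
def pointSource (hκ : 0 < κ.re) (y : Plane) : EuclideanSpace ℂ (Fin n) →L[ℂ] L2 n :=
  ((ContinuousLinearMap.lsmul ℂ ℂ).flip.compLpL₂ 2 volume).flip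
    (((memLp_green hκ).comp_measurePreserving (measurePreserving_sub_right volume y)).toLp _)

theorem pointSource_ae_eq (hκ : 0 < κ.re) (y : Plane) (c : EuclideanSpace ℂ (Fin n)) :
    pointSource n hκ y c =ᵐ[volume] fun v => green κ (v - y) • c := by
  have hmem := (memLp_green hκ).comp_measurePreserving (measurePreserving_sub_right volume y)
  filter_upwards [((ContinuousLinearMap.lsmul ℂ ℂ).flip c).coeFn_compLp (hmem.toLp _),
    hmem.coeFn_toLp] with v hL hgreen
  refine hL.trans ?_
  rw [hgreen]
  rfl

theorem fourier_pointSource_ae_eq (hκ : 0 < κ.re) (y : Plane) (c : EuclideanSpace ℂ (Fin n)) :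
    (𝓕 (pointSource n hκ y c) : L2 n) =ᵐ[volume]
      fun ξ => ((Real.fourierChar (-inner ℝ y ξ) : ℂ) * resolventSymbol κ ξ) • c := by
  have hint : Integrable fun v => green κ (v - y) • c :=
    ((integrable_green hκ).comp_sub_right y).smul_const c
  have hsymbol : MemLp (resolventSymbol κ : Plane → ℂ) 2 :=
    memLp_two_resolventSymbol (by simp) hκ
  have hcont : Continuous fun ξ : Plane =>
      ((Real.fourierChar (-inner ℝ y ξ) : ℂ) * resolventSymbol κ ξ) • c :=
    .smul (.mul (continuous_subtype_val.comp (Real.continuous_fourierChar.comp (by fun_prop)))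
      (continuous_resolventSymbol hκ)) continuous_const
  have hmem : MemLp (𝓕 fun v => green κ (v - y) • c) 2 := by
    rw [fourier_green_sub_smul hκ]
    refine hsymbol.of_le_mul (c := ‖c‖) hcont.aestronglyMeasurable (ae_of_all _ fun ξ => ?_)
    rw [norm_smul, norm_mul, Circle.norm_coe, one_mul, mul_comm]
  exact fourier_green_sub_smul hκ y c ▸
    fourier_ae_eq_of_ae_eq hint hmem (pointSource_ae_eq hκ y c)

theorem exists_continuous_freeResolvent {κ' : ℂ} (hκ : 0 < κ.re) (hκ' : 0 < κ'.re)
    (hconj : κ' = (starRingEnd ℂ) κ) (φ : L2 n) :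
    ∃ u : Plane → EuclideanSpace ℂ (Fin n), Continuous u ∧ freeResolvent n hκ φ =ᵐ[volume] u ∧
      ∀ y c, inner ℂ c (u y) = inner ℂ (pointSource n hκ' y c) φ := by
  have hint : Integrable (𝓕 (freeResolvent n hκ φ) : L2 n) := by
    have hmul : MemLp (fun ξ => resolventSymbol κ ξ • (𝓕 φ : L2 n) ξ) 1 volume :=
      (Lp.memLp (𝓕 φ : L2 n)).smul (memLp_two_resolventSymbol (by simp) hκ)
    exact (memLp_one_iff_integrable.mp hmul).congr (fourier_freeResolvent_ae_eq hκ φ).symm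
  refine ⟨𝓕⁻ ((𝓕 (freeResolvent n hκ φ) : L2 n) : Plane → EuclideanSpace ℂ (Fin n)),
    continuous_fourierInv_of_integrable hint, ?_, fun y c => ?_⟩
  · simpa only [FourierTransform.fourierInv_fourier_eq] using fourierInv_ae_eq_fourierInv hint
  · rw [inner_fourierInv_eq_integral hint, ← Lp.inner_fourier_eq, L2.inner_def]
    refine integral_congr_ae ?_
    filter_upwards [fourier_freeResolvent_ae_eq hκ φ, fourier_pointSource_ae_eq hκ' y c]
      with ξ hres hsource
    rw [hres, hsource, hconj, ← conj_resolventSymbol]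
    simp only [inner_smul_left, inner_smul_right, map_mul, Complex.conj_conj]
    ring

end Resolvent

/-! ### Expansions at the points `x_j` -/

section Expansion

theorem tendsto_sub_nhdsNE {E : Type*} [TopologicalSpace E] [AddGroup E] [IsTopologicalAddGroup E]
    (p : E) : Tendsto (fun y => y - p) (𝓝[≠] p) (𝓝[≠] 0) := by
  have h : Tendsto (Homeomorph.subRight p) (𝓝[≠] p) (𝓝[≠] (p - p)) :=
    ((Homeomorph.subRight p).map_punctured_nhds_eq p).le
  rwa [sub_self] at h

theorem tendsto_log_norm_sub_nhdsNE {E : Type*} [NormedAddCommGroup E] (p : E) :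
    Tendsto (fun y => Real.log ‖y - p‖) (𝓝[≠] p) atBot :=
  Real.tendsto_log_nhdsGT_zero.comp
    (tendsto_norm_nhdsNE_zero.comp (tendsto_sub_nhdsNE p))

theorem tendsto_inv_log_smul {E F : Type*} [NormedAddCommGroup E] [NormedAddCommGroup F]
    [NormedSpace ℝ F] {g : E → F} {p : E} {a b : F} {r : ℝ}
    (h : Tendsto (fun y => g y + (r * Real.log ‖y - p‖) • a) (𝓝[≠] p) (𝓝 b)) :
    Tendsto (fun y => (Real.log ‖y - p‖)⁻¹ • g y) (𝓝[≠] p) (𝓝 (-r • a)) := by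
  have hlog := tendsto_log_norm_sub_nhdsNE p
  have hlim := (hlog.inv_tendsto_atBot.smul h).sub (tendsto_const_nhds (x := r • a))
  rw [zero_smul, zero_sub, ← neg_smul] at hlim
  refine hlim.congr' ?_
  filter_upwards [hlog.eventually_ne_atBot 0] with y hy
  rw [Pi.inv_apply, smul_add, smul_smul, mul_comm r, inv_mul_cancel_left₀ hy, add_sub_cancel_right]

variable {n m : ℕ} {x : Fin m → Plane}

/-- `f` is continuous off the points `x_j`, and `f = -(2π)⁻¹ a_j ln |· - x_j| + b_j + o(1)`
at `x_j`. -/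
def HasExpansion (x : Fin m → Plane) (f : L2 n) (a b : BoundarySpace m n) : Prop :=
  ∃ g : Plane → EuclideanSpace ℂ (Fin n), f =ᵐ[volume] g ∧ ContinuousOn g (range x)ᶜ ∧
    ∀ j, Tendsto (fun y => g y + (1 / (2 * Real.pi) * Real.log ‖y - x j‖) • a j) (𝓝[≠] x j)
      (𝓝 (b j))

theorem HasExpansion.unique {f : L2 n} {a b a' b' : BoundarySpace m n}
    (h : HasExpansion x f a b) (h' : HasExpansion x f a' b') : a = a' ∧ b = b' := by
  obtain ⟨g, hg, hc, ht⟩ := h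
  obtain ⟨g', hg', hc', ht'⟩ := h'
  have heqOn : EqOn g g' (range x)ᶜ :=
    Measure.eqOn_open_of_ae_eq (ae_restrict_of_ae (hg.symm.trans hg'))
      (finite_range x).isClosed.isOpen_compl hc hc'
  have heq : ∀ j, g =ᶠ[𝓝[≠] x j] g' := fun j =>
    heqOn.eventuallyEq_of_mem (nhdsNE_le_cofinite _ (finite_range x).compl_mem_cofinite)
  have ha : a = a' := by
    refine PiLp.ext fun j => ?_
    have hlim := (tendsto_inv_log_smul (ht j)).congr' ((heq j).mono fun y hy => by rw [hy])
    exact smul_right_injective _ (by simp [Real.pi_ne_zero])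
      (tendsto_nhds_unique hlim (tendsto_inv_log_smul (ht' j)))
  subst ha
  exact ⟨rfl, PiLp.ext fun j =>
    tendsto_nhds_unique ((ht j).congr' ((heq j).mono fun y hy => by rw [hy])) (ht' j)⟩

theorem isPointTriplet_iff {B : BoundaryTriplet (minimalOperator n x) (BoundarySpace m n)} :
    IsPointTriplet B ↔ ∀ f : (minimalOperator n x).adjoint.domain,
      HasExpansion x (f : L2 n) (B.Γ₀ f) (B.Γ₁ f) := by
  refine forall_congr' fun f => ⟨?_, ?_⟩
  · rintro ⟨g, ξ, hg, hc, h⟩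
    refine ⟨g, hg, hc, fun j => ?_⟩
    obtain ⟨-, hΓ₀, hΓ₁⟩ := h j
    refine hΓ₁.congr fun y => ?_
    rw [hΓ₀, smul_smul, sub_eq_add_neg, ← neg_smul]
    congr 2
    field_simp
  · rintro ⟨g, hg, hc, ht⟩
    refine ⟨g, fun j => -(1 / (2 * Real.pi)) • B.Γ₀ f j, hg, hc, fun j =>
      ⟨tendsto_inv_log_smul (ht j), ?_, (ht j).congr fun y => ?_⟩⟩
    · have hpi : -(2 * Real.pi) * -(1 / (2 * Real.pi)) = 1 := by field_simp
      rw [smul_smul, hpi, one_smul]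
    · rw [smul_smul, mul_neg, neg_smul, sub_neg_eq_add]
      ring_nf

end Expansion

/-! ### Superpositions of point sources -/

section Sources

/-- The operator `A ⊗ 1` on tuples of vectors of `E`. -/
def ampliation {ι ι' E : Type*} [Fintype ι] [Fintype ι'] [NormedAddCommGroup E]
    [InnerProductSpace ℂ E] (A : Matrix ι ι' ℂ) :
    PiLp 2 (fun _ : ι' => E) →ₗ[ℂ] PiLp 2 fun _ : ι => E where
  toFun c := WithLp.toLp 2 fun j => ∑ k, A j k • c k
  map_add' c d := PiLp.ext fun j => by simp [smul_add, Finset.sum_add_distrib]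
  map_smul' a c := PiLp.ext fun j => by simp [Finset.smul_sum, smul_comm a]

theorem inner_ampliation {ι ι' E : Type*} [Fintype ι] [Fintype ι'] [NormedAddCommGroup E]
    [InnerProductSpace ℂ E] (A : Matrix ι ι' ℂ) (c : PiLp 2 fun _ : ι' => E)
    (d : PiLp 2 fun _ : ι => E) :
    inner ℂ d (ampliation A c) = inner ℂ (ampliation A.conjTranspose d) c := by
  simp only [ampliation, LinearMap.coe_mk, AddHom.coe_mk, PiLp.inner_apply, inner_sum, sum_inner,
    inner_smul_left, inner_smul_right, Matrix.conjTranspose_apply, RCLike.star_def,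
    Complex.conj_conj]
  exact Finset.sum_comm

variable {n m : ℕ} {κ κ' : ℂ} {x : Fin m → Plane}

/-- The constant terms at the points `x_j` of the functions `green κ (· - x_k)`. -/
def greenMatrix (κ : ℂ) (x : Fin m → Plane) : Matrix (Fin m) (Fin m) ℂ :=
  Matrix.of fun j k => if j = k then greenConst κ else green κ (x j - x k)

theorem conjTranspose_greenMatrix (hκ : 0 < κ.re) (x : Fin m → Plane) :
    (greenMatrix κ x).conjTranspose = greenMatrix ((starRingEnd ℂ) κ) x := by
  ext j k
  rcases eq_or_ne j k with rfl | hjk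
  · simp [greenMatrix, conj_greenConst hκ]
  · simp [greenMatrix, hjk, hjk.symm, green, conj_macdonald, norm_sub_rev (x k)]

theorem continuousAt_green_sub (hκ : 0 < κ.re) {p y : Plane} (hy : y ≠ p) :
    ContinuousAt (fun y => green κ (y - p)) y :=
  ((continuousOn_green hκ).continuousAt (isOpen_compl_singleton.mem_nhds (sub_ne_zero.mpr hy))).comp
    (f := fun y => y - p) (by fun_prop)

theorem tendsto_green_sub (hκ : 0 < κ.re) (hx : Function.Injective x) (j k : Fin m) :
    Tendsto (fun y => green κ (y - x k) +
        if j = k then 1 / (2 * Real.pi) * (Real.log ‖y - x j‖ : ℂ) else 0) (𝓝[≠] x j)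
      (𝓝 (greenMatrix κ x j k)) := by
  rcases eq_or_ne j k with rfl | hjk
  · simpa [greenMatrix, Function.comp_def] using
      (tendsto_green_add_log hκ).comp (tendsto_sub_nhdsNE (x j))
  · simpa [greenMatrix, hjk] using
      (continuousAt_green_sub hκ (hx.ne hjk)).tendsto.mono_left nhdsWithin_le_nhds

theorem tendsto_sum_green_smul (hκ : 0 < κ.re) (hx : Function.Injective x)
    (c : BoundarySpace m n) (j : Fin m) :
    Tendsto (fun y => ∑ k, green κ (y - x k) • c k +
        (1 / (2 * Real.pi) * Real.log ‖y - x j‖) • c j) (𝓝[≠] x j)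
      (𝓝 (ampliation (greenMatrix κ x) c j)) := by
  refine (tendsto_finsetSum Finset.univ fun k _ =>
    (tendsto_green_sub hκ hx j k).smul_const (c k)).congr fun y => ?_
  simp only [add_smul, ite_smul, zero_smul, Finset.sum_add_distrib, Finset.sum_ite_eq,
    Finset.mem_univ, if_true]
  rw [← Complex.coe_smul (1 / (2 * Real.pi) * Real.log ‖y - x j‖)]
  push_cast
  rfl

variable (n) in
/-- The operator `c ↦ Σ_j green κ (· - x_j) c_j`. -/
def source (hκ : 0 < κ.re) (x : Fin m → Plane) : BoundarySpace m n →L[ℂ] L2 n :=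
  ∑ j, pointSource n hκ (x j) ∘L PiLp.proj 2 _ j

theorem source_apply (hκ : 0 < κ.re) (x : Fin m → Plane) (c : BoundarySpace m n) :
    source n hκ x c = ∑ j, pointSource n hκ (x j) (c j) := by
  simp [source]

theorem source_ae_eq (hκ : 0 < κ.re) (x : Fin m → Plane) (c : BoundarySpace m n) :
    source n hκ x c =ᵐ[volume] fun y => ∑ j, green κ (y - x j) • c j := by
  rw [source_apply]
  filter_upwards [Lp.coeFn_fun_finsetSum Finset.univ fun j => pointSource n hκ (x j) (c j),
    ae_all_iff.mpr fun j => pointSource_ae_eq hκ (x j) (c j)] with y hsum hsource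
  rw [hsum]
  exact Finset.sum_congr rfl fun j _ => hsource j

theorem conj_re_pos (hκ : 0 < κ.re) : 0 < ((starRingEnd ℂ) κ).re := by
  rwa [Complex.conj_re]

variable (n) in
/-- The point evaluations `φ ↦ {((-Δ + κ²)⁻¹ φ)(x_j)}_j`. -/
def evalAt (hκ : 0 < κ.re) (x : Fin m → Plane) : L2 n →L[ℂ] BoundarySpace m n :=
  ContinuousLinearMap.adjoint (source n (conj_re_pos hκ) x)

theorem inner_source (hκ : 0 < κ.re) (hκ' : 0 < κ'.re) (hconj : κ' = (starRingEnd ℂ) κ)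
    (c : BoundarySpace m n) (ψ : L2 n) :
    inner ℂ (source n hκ' x c) ψ = inner ℂ c (evalAt n hκ x ψ) := by
  subst hconj
  rw [evalAt, ContinuousLinearMap.adjoint_inner_right]

theorem exists_continuous_freeResolvent_evalAt (hκ : 0 < κ.re) (x : Fin m → Plane) (φ : L2 n) :
    ∃ u : Plane → EuclideanSpace ℂ (Fin n), Continuous u ∧ freeResolvent n hκ φ =ᵐ[volume] u ∧
      ∀ j, u (x j) = evalAt n hκ x φ j := by
  obtain ⟨u, hu, he, hv⟩ := exists_continuous_freeResolvent hκ (conj_re_pos hκ) rfl φ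
  have heval : (WithLp.toLp 2 fun j => u (x j) : BoundarySpace m n) = evalAt n hκ x φ := by
    refine ext_inner_left ℂ fun c => ?_
    rw [← inner_source hκ (conj_re_pos hκ) rfl, source_apply, sum_inner, PiLp.inner_apply]
    exact Finset.sum_congr rfl fun j _ => hv (x j) (c j)
  exact ⟨u, hu, he, fun j => by rw [← heval]⟩

theorem hasExpansion_freeResolvent_add_source (hκ : 0 < κ.re) (hx : Function.Injective x)
    (φ : L2 n) (c : BoundarySpace m n) :
    HasExpansion x (freeResolvent n hκ φ + source n hκ x c) c
      (evalAt n hκ x φ + ampliation (greenMatrix κ x) c) := by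
  obtain ⟨u, hu, he, hv⟩ := exists_continuous_freeResolvent_evalAt hκ x φ
  refine ⟨fun y => u y + ∑ k, green κ (y - x k) • c k, ?_, ?_, fun j => ?_⟩
  · exact (Lp.coeFn_add _ _).trans (he.add (source_ae_eq hκ x c))
  · refine hu.continuousOn.add (continuousOn_finsetSum _ fun k _ y hy => ?_)
    exact ((continuousAt_green_sub hκ fun h => hy ⟨k, h.symm⟩).smul
      continuousAt_const).continuousWithinAt
  · have hreg : Tendsto u (𝓝[≠] x j) (𝓝 (evalAt n hκ x φ j)) :=
      hv j ▸ (hu.tendsto (x j)).mono_left nhdsWithin_le_nhds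
    simpa only [add_assoc, PiLp.add_apply] using hreg.add (tendsto_sum_green_smul hκ hx c j)

theorem eq_zero_of_freeResolvent_eq_source (hκ : 0 < κ.re) (hx : Function.Injective x) {φ : L2 n}
    {c : BoundarySpace m n} (h : freeResolvent n hκ φ = source n hκ x c) : c = 0 := by
  have hφ := hasExpansion_freeResolvent_add_source hκ hx φ 0
  have hc := hasExpansion_freeResolvent_add_source hκ hx 0 c
  rw [map_zero, zero_add, ← h] at hc
  rw [map_zero, add_zero] at hφ
  exact (hc.unique hφ).1

theorem source_injective (hκ : 0 < κ.re) (hx : Function.Injective x) :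
    Function.Injective (source n hκ x) :=
  (injective_iff_map_eq_zero _).mpr fun c hc =>
    eq_zero_of_freeResolvent_eq_source hκ hx (φ := 0) (by rw [hc, map_zero])

theorem freeResolvent_injective (hκ : 0 < κ.re) : Function.Injective (freeResolvent n hκ) := by
  refine (injective_iff_map_eq_zero _).mpr fun φ hφ => ?_
  have h := neg_laplacian_freeResolvent hκ φ
  simp only [hφ] at h
  have hzero : (⟨0, (sobolev n).zero_mem⟩ : sobolev n) = 0 := rfl
  rw [hzero, map_zero, smul_zero, neg_zero, add_zero] at h
  exact h.symm

theorem evalAt_surjective (hκ : 0 < κ.re) (hx : Function.Injective x) :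
    Function.Surjective (evalAt n hκ x) := by
  have hrange : (evalAt n hκ x).rangeᗮ = ⊥ := by
    rw [ContinuousLinearMap.orthogonal_range, evalAt, ContinuousLinearMap.adjoint_adjoint]
    exact LinearMap.ker_eq_bot.mpr (source_injective (conj_re_pos hκ) hx)
  exact LinearMap.range_eq_top.mp (Submodule.orthogonal_eq_bot_iff.mp hrange)

theorem exists_eq_source_of_orthogonal (hκ : 0 < κ.re) (hκ' : 0 < κ'.re)
    (hconj : κ' = (starRingEnd ℂ) κ) {f : L2 n}
    (hf : ∀ ψ : L2 n, evalAt n hκ x ψ = 0 → inner ℂ ψ f = 0) : ∃ c, source n hκ' x c = f := by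
  subst hconj
  have hker : (source n hκ' x).rangeᗮ = (evalAt n hκ x).ker :=
    (source n hκ' x).orthogonal_range
  have hmem : f ∈ (source n hκ' x).rangeᗮᗮ := by
    rw [hker, Submodule.mem_orthogonal]
    exact fun ψ hψ => hf ψ hψ
  rwa [Submodule.orthogonal_orthogonal] at hmem

end Sources

/-! ### The minimal operator and its adjoint -/

section Operator

variable {n m : ℕ} {κ κ' : ℂ} {x : Fin m → Plane}

theorem freeResolvent_mem_vanishing_iff (hκ : 0 < κ.re) (x : Fin m → Plane) (φ : L2 n) :
    freeResolvent n hκ φ ∈ vanishing n x ↔ evalAt n hκ x φ = 0 := by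
  obtain ⟨u, hu, he, hv⟩ := exists_continuous_freeResolvent_evalAt hκ x φ
  constructor
  · rintro ⟨g, hg, heg, hz⟩
    have hug : u = g := (hu.ae_eq_iff_eq volume hg).mp (he.symm.trans heg)
    exact PiLp.ext fun j => by rw [← hv, hug, hz, PiLp.zero_apply]
  · exact fun h => ⟨u, hu, he, fun j => by rw [hv, h, PiLp.zero_apply]⟩

theorem freeResolvent_mem_domain (hκ : 0 < κ.re) (x : Fin m → Plane) {φ : L2 n}
    (h : evalAt n hκ x φ = 0) : freeResolvent n hκ φ ∈ (minimalOperator n x).domain :=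
  ⟨(freeResolvent_mem_vanishing_iff hκ x φ).mpr h, freeResolvent_mem_sobolev hκ φ⟩

theorem minimalOperator_apply (f : (minimalOperator n x).domain) :
    minimalOperator n x f = -laplacian n ⟨(f : L2 n), f.2.2⟩ :=
  (LinearPMap.mk (sobolev n) (-laplacian n)).domRestrict_apply (x := f)
    (y := ⟨(f : L2 n), f.2.2⟩) rfl

theorem minimalOperator_freeResolvent (hκ : 0 < κ.re) (x : Fin m → Plane) {φ : L2 n}
    (h : evalAt n hκ x φ = 0) :
    minimalOperator n x ⟨freeResolvent n hκ φ, freeResolvent_mem_domain hκ x h⟩ =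
      φ - κ ^ 2 • freeResolvent n hκ φ := by
  rw [minimalOperator_apply]
  exact eq_sub_of_add_eq (neg_laplacian_freeResolvent hκ φ)

theorem freeResolvent_minimalOperator (hκ : 0 < κ.re) (f : (minimalOperator n x).domain) :
    freeResolvent n hκ (minimalOperator n x f + κ ^ 2 • (f : L2 n)) = f := by
  rw [minimalOperator_apply]
  exact freeResolvent_neg_laplacian hκ ⟨(f : L2 n), f.2.2⟩

theorem evalAt_minimalOperator (hκ : 0 < κ.re) (f : (minimalOperator n x).domain) :
    evalAt n hκ x (minimalOperator n x f + κ ^ 2 • (f : L2 n)) = 0 := by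
  rw [← freeResolvent_mem_vanishing_iff, freeResolvent_minimalOperator]
  exact f.2.1

theorem zero_lt_one_re : 0 < (1 : ℂ).re := by simp

theorem isClosed_minimalOperator (x : Fin m → Plane) : (minimalOperator n x).IsClosed := by
  have hgraph : ((minimalOperator n x).graph : Set (L2 n × L2 n)) =
      {p | freeResolvent n zero_lt_one_re (p.2 + p.1) = p.1} ∩
        {p | evalAt n zero_lt_one_re x (p.2 + p.1) = 0} := by
    ext ⟨f, g⟩
    simp only [SetLike.mem_coe, LinearPMap.mem_graph_iff, mem_inter_iff, mem_ofPred_eq]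
    constructor
    · rintro ⟨v, rfl, rfl⟩
      simpa only [one_pow, one_smul] using And.intro
        (freeResolvent_minimalOperator zero_lt_one_re v) (evalAt_minimalOperator zero_lt_one_re v)
    · rintro ⟨hR, heval⟩
      refine ⟨⟨_, freeResolvent_mem_domain zero_lt_one_re x heval⟩, hR, ?_⟩
      rw [minimalOperator_freeResolvent zero_lt_one_re x heval, hR, one_pow, one_smul,
        add_sub_cancel_right]
  rw [LinearPMap.IsClosed, hgraph]
  exact (isClosed_eq (by fun_prop) continuous_fst).inter
    (isClosed_eq (by fun_prop) continuous_const)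

theorem isFormalAdjoint_minimalOperator (f g : (minimalOperator n x).domain) :
    inner ℂ (g : L2 n) (minimalOperator n x f) = inner ℂ (minimalOperator n x g) (f : L2 n) := by
  have hf := freeResolvent_minimalOperator zero_lt_one_re f
  have hg := freeResolvent_minimalOperator zero_lt_one_re g
  rw [one_pow, one_smul] at hf hg
  have h := inner_freeResolvent zero_lt_one_re zero_lt_one_re (by simp)
    (minimalOperator n x f + (f : L2 n)) (minimalOperator n x g + (g : L2 n))
  rw [hf, hg, inner_add_left, inner_add_right] at h
  exact (add_right_cancel h).symm

theorem dense_domain_minimalOperator (hx : Function.Injective x) :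
    Dense ((minimalOperator n x).domain : Set (L2 n)) := by
  rw [Submodule.dense_iff_topologicalClosure_eq_top, Submodule.topologicalClosure_eq_top_iff,
    Submodule.eq_bot_iff]
  intro w hw
  obtain ⟨c, hc⟩ := exists_eq_source_of_orthogonal (x := x) zero_lt_one_re zero_lt_one_re (by simp)
    (f := freeResolvent n zero_lt_one_re w) fun ψ hψ => by
      rw [inner_freeResolvent zero_lt_one_re zero_lt_one_re (by simp)]
      exact (Submodule.mem_orthogonal _ _).mp hw _ (freeResolvent_mem_domain zero_lt_one_re x hψ)
  apply freeResolvent_injective zero_lt_one_re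
  rw [← hc, eq_zero_of_freeResolvent_eq_source zero_lt_one_re hx hc.symm, map_zero, map_zero]

theorem isClosedSymmetric_minimalOperator (hx : Function.Injective x) :
    IsClosedSymmetric (minimalOperator n x) :=
  ⟨dense_domain_minimalOperator hx, isClosed_minimalOperator x, isFormalAdjoint_minimalOperator⟩

theorem inner_freeResolvent_add_source_minimalOperator (hκ : 0 < κ.re) (φ : L2 n)
    (c : BoundarySpace m n) (v : (minimalOperator n x).domain) :
    inner ℂ (φ - κ ^ 2 • (freeResolvent n hκ φ + source n hκ x c)) (v : L2 n) =
      inner ℂ (freeResolvent n hκ φ + source n hκ x c) (minimalOperator n x v) := by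
  have hκ' := conj_re_pos hκ
  set ψ := minimalOperator n x v + (starRingEnd ℂ) κ ^ 2 • (v : L2 n) with hψ
  have hsource : inner ℂ (source n hκ x c) ψ = 0 := by
    rw [inner_source hκ' hκ (by simp), evalAt_minimalOperator hκ' v, inner_zero_right]
  have hres : inner ℂ (freeResolvent n hκ φ) ψ = inner ℂ φ (v : L2 n) := by
    rw [← inner_freeResolvent hκ' hκ (by simp), freeResolvent_minimalOperator hκ' v]
  rw [eq_sub_of_add_eq hψ.symm, inner_sub_left, inner_sub_right, inner_smul_left,
    inner_smul_right, map_pow, inner_add_left _ _ ψ, hsource, hres, add_zero]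

theorem freeResolvent_add_source_mem_adjoint (hκ : 0 < κ.re) (x : Fin m → Plane) (φ : L2 n)
    (c : BoundarySpace m n) :
    freeResolvent n hκ φ + source n hκ x c ∈ (minimalOperator n x).adjoint.domain :=
  LinearPMap.mem_adjoint_domain_of_exists _
    ⟨_, inner_freeResolvent_add_source_minimalOperator hκ φ c⟩

theorem exists_source_eq_sub (hκ : 0 < κ.re) (hx : Function.Injective x)
    (f : (minimalOperator n x).adjoint.domain) :
    ∃ c, source n hκ x c =
      f - freeResolvent n hκ ((minimalOperator n x).adjoint f + κ ^ 2 • (f : L2 n)) := by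
  have hκ' := conj_re_pos hκ
  refine exists_eq_source_of_orthogonal hκ' hκ (by simp) fun ψ hψ => ?_
  have hadj := LinearPMap.adjoint_isFormalAdjoint (dense_domain_minimalOperator hx) f
    ⟨_, freeResolvent_mem_domain hκ' x hψ⟩
  rw [minimalOperator_freeResolvent hκ' x hψ, inner_sub_right, inner_smul_right] at hadj
  have hres : inner ℂ ((minimalOperator n x).adjoint f + κ ^ 2 • (f : L2 n))
      (freeResolvent n hκ' ψ) = inner ℂ (f : L2 n) ψ := by
    rw [inner_add_left, inner_smul_left, map_pow, hadj, sub_add_cancel]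
  rw [inner_sub_right, inner_freeResolvent hκ hκ' rfl, ← inner_conj_symm ψ,
    ← inner_conj_symm (freeResolvent n hκ' ψ), hres, sub_self]

variable (n) in
/-- The description of `dom H*` as the direct sum of the range of the free resolvent and of the
point sources: `(φ, c)` stands for `(-Δ + κ²)⁻¹ φ + Σ_j green κ (· - x_j) c_j`. -/
def adjointDomainEquiv (hκ : 0 < κ.re) (hx : Function.Injective x) :
    (L2 n × BoundarySpace m n) ≃ₗ[ℂ] (minimalOperator n x).adjoint.domain :=
  LinearEquiv.ofBijective
    (((freeResolvent n hκ).coprod (source n hκ x)).toLinearMap.codRestrict _ fun p =>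
      freeResolvent_add_source_mem_adjoint hκ x p.1 p.2) <| by
    constructor
    · refine (injective_iff_map_eq_zero _).mpr fun p hp => ?_
      have hsum : freeResolvent n hκ p.1 + source n hκ x p.2 = 0 := congrArg Subtype.val hp
      have hp₂ : -p.2 = 0 := eq_zero_of_freeResolvent_eq_source hκ hx
        ((eq_neg_of_add_eq_zero_left hsum).trans (map_neg (source n hκ x) p.2).symm)
      rw [neg_eq_zero] at hp₂
      rw [hp₂, map_zero, add_zero] at hsum
      exact Prod.ext (freeResolvent_injective hκ (hsum.trans (map_zero _).symm)) hp₂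
    · intro f
      obtain ⟨c, hc⟩ := exists_source_eq_sub hκ hx f
      exact ⟨(_, c), Subtype.ext ((congrArg _ hc).trans (add_sub_cancel _ _))⟩

theorem coe_adjointDomainEquiv (hκ : 0 < κ.re) (hx : Function.Injective x)
    (p : L2 n × BoundarySpace m n) :
    (adjointDomainEquiv n hκ hx p : L2 n) = freeResolvent n hκ p.1 + source n hκ x p.2 :=
  rfl

theorem adjoint_adjointDomainEquiv (hκ : 0 < κ.re) (hx : Function.Injective x)
    (p : L2 n × BoundarySpace m n) :
    (minimalOperator n x).adjoint (adjointDomainEquiv n hκ hx p) =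
      p.1 - κ ^ 2 • (adjointDomainEquiv n hκ hx p : L2 n) :=
  LinearPMap.adjoint_apply_eq (dense_domain_minimalOperator hx) _
    (inner_freeResolvent_add_source_minimalOperator hκ p.1 p.2)

theorem coe_eq_freeResolvent_add_source (hκ : 0 < κ.re) (hx : Function.Injective x)
    (f : (minimalOperator n x).adjoint.domain) :
    (f : L2 n) = freeResolvent n hκ ((adjointDomainEquiv n hκ hx).symm f).1 +
      source n hκ x ((adjointDomainEquiv n hκ hx).symm f).2 := by
  rw [← coe_adjointDomainEquiv hκ hx, LinearEquiv.apply_symm_apply]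

theorem adjoint_apply_eq_sub (hκ : 0 < κ.re) (hx : Function.Injective x)
    (f : (minimalOperator n x).adjoint.domain) :
    (minimalOperator n x).adjoint f =
      ((adjointDomainEquiv n hκ hx).symm f).1 - κ ^ 2 • (f : L2 n) := by
  have h := adjoint_adjointDomainEquiv hκ hx ((adjointDomainEquiv n hκ hx).symm f)
  rwa [LinearEquiv.apply_symm_apply] at h

theorem hasExpansion_adjointDomainEquiv (hκ : 0 < κ.re) (hx : Function.Injective x)
    (p : L2 n × BoundarySpace m n) :
    HasExpansion x (adjointDomainEquiv n hκ hx p : L2 n) p.2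
      (evalAt n hκ x p.1 + ampliation (greenMatrix κ x) p.2) :=
  hasExpansion_freeResolvent_add_source hκ hx p.1 p.2

end Operator

/-! ### The boundary triplet -/

section Triplet

variable {n m : ℕ} {κ : ℂ} {x : Fin m → Plane}

variable (x) in
/-- The constant terms at the points `x_j` of `(-Δ + κ²)⁻¹ φ + Σ_j green κ (· - x_j) c_j`, as a
function of `(φ, c)`. -/
def regularValue (hκ : 0 < κ.re) : L2 n × BoundarySpace m n →ₗ[ℂ] BoundarySpace m n :=
  (evalAt n hκ x).toLinearMap.coprod (ampliation (greenMatrix κ x))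

theorem green_identity_of_decomposition (hκ : 0 < κ.re) (hreal : (starRingEnd ℂ) κ = κ)
    {p q : L2 n × BoundarySpace m n} {f f' g g' : L2 n}
    (hf : f = freeResolvent n hκ p.1 + source n hκ x p.2) (hf' : f' = p.1 - κ ^ 2 • f)
    (hg : g = freeResolvent n hκ q.1 + source n hκ x q.2) (hg' : g' = q.1 - κ ^ 2 • g) :
    inner ℂ g f' - inner ℂ g' f =
      inner ℂ q.2 (regularValue x hκ p) - inner ℂ (regularValue x hκ q) p.2 := by
  have hres := inner_freeResolvent hκ hκ hreal.symm p.1 q.1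
  have hsource := inner_source (x := x) hκ hκ hreal.symm q.2 p.1
  have hsource' : inner ℂ q.1 (source n hκ x p.2) = inner ℂ (evalAt n hκ x q.1) p.2 := by
    rw [← inner_conj_symm, inner_source hκ hκ hreal.symm, inner_conj_symm]
  have hmatrix : inner ℂ q.2 (ampliation (greenMatrix κ x) p.2) =
      inner ℂ (ampliation (greenMatrix κ x) q.2) p.2 := by
    rw [inner_ampliation, conjTranspose_greenMatrix hκ, hreal]
  rw [hf', hg', hf, hg, regularValue, LinearMap.coprod_apply, LinearMap.coprod_apply,
    ContinuousLinearMap.coe_coe]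
  simp only [inner_sub_left, inner_sub_right, inner_smul_left, inner_smul_right, map_pow, hreal,
    inner_add_left, inner_add_right, hmatrix, hres, hsource, hsource']
  ring

theorem regularValue_prodMk_surjective (hκ : 0 < κ.re) (hx : Function.Injective x) :
    Function.Surjective fun p : L2 n × BoundarySpace m n => (p.2, regularValue x hκ p) := by
  rintro ⟨c, d⟩
  obtain ⟨φ, hφ⟩ := evalAt_surjective (n := n) hκ hx (d - ampliation (greenMatrix κ x) c)
  exact ⟨(φ, c), Prod.ext rfl ((congrArg (· + ampliation (greenMatrix κ x) c) hφ).trans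
    (sub_add_cancel _ _))⟩

/-- The boundary triplet of the minimal operator, read off the decomposition of `dom H*` at
`κ = 1`. -/
def pointTriplet (n : ℕ) (hx : Function.Injective x) :
    BoundaryTriplet (minimalOperator n x) (BoundarySpace m n) where
  Γ₀ := .snd ℂ _ _ ∘ₗ (adjointDomainEquiv n zero_lt_one_re hx).symm.toLinearMap
  Γ₁ := regularValue x zero_lt_one_re ∘ₗ
    (adjointDomainEquiv n zero_lt_one_re hx).symm.toLinearMap
  green f g := green_identity_of_decomposition zero_lt_one_re (map_one _)
    (coe_eq_freeResolvent_add_source _ hx f) (adjoint_apply_eq_sub _ hx f)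
    (coe_eq_freeResolvent_add_source _ hx g) (adjoint_apply_eq_sub _ hx g)
  surjective := (regularValue_prodMk_surjective zero_lt_one_re hx).comp
    (adjointDomainEquiv n zero_lt_one_re hx).symm.surjective

theorem isPointTriplet_pointTriplet (hx : Function.Injective x) :
    IsPointTriplet (pointTriplet n hx) := by
  refine isPointTriplet_iff.mpr fun f => ?_
  have h := hasExpansion_adjointDomainEquiv zero_lt_one_re hx
    ((adjointDomainEquiv n zero_lt_one_re hx).symm f)
  rwa [LinearEquiv.apply_symm_apply] at h

/-! ### The `γ`-field and the Weyl function -/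

namespace IsPointTriplet

variable {B : BoundaryTriplet (minimalOperator n x) (BoundarySpace m n)}

theorem boundary_values (hB : IsPointTriplet B) (hκ : 0 < κ.re) (hx : Function.Injective x)
    (p : L2 n × BoundarySpace m n) :
    B.Γ₀ (adjointDomainEquiv n hκ hx p) = p.2 ∧
      B.Γ₁ (adjointDomainEquiv n hκ hx p) =
        evalAt n hκ x p.1 + ampliation (greenMatrix κ x) p.2 :=
  (isPointTriplet_iff.mp hB _).unique (hasExpansion_adjointDomainEquiv hκ hx p)

theorem A₀_freeResolvent (hB : IsPointTriplet B) (hκ : 0 < κ.re) (hx : Function.Injective x)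
    (φ : L2 n) :
    ∃ h : freeResolvent n hκ φ ∈ B.A₀.domain,
      B.A₀ ⟨freeResolvent n hκ φ, h⟩ - -κ ^ 2 • freeResolvent n hκ φ = φ := by
  have hcoe : (adjointDomainEquiv n hκ hx (φ, 0) : L2 n) = freeResolvent n hκ φ := by
    rw [coe_adjointDomainEquiv, map_zero, add_zero]
  have h := B.mem_A₀ _ (hB.boundary_values hκ hx (φ, 0)).1
  rw [adjoint_adjointDomainEquiv] at h
  simpa only [hcoe, neg_smul, sub_neg_eq_add, eq_sub_iff_add_eq] using h

theorem mem_domain_A₀ (hB : IsPointTriplet B) (hκ : 0 < κ.re) (hx : Function.Injective x)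
    (f : B.A₀.domain) : ∃ φ, freeResolvent n hκ φ = f := by
  obtain ⟨g, hg, hgf⟩ := f.2.1
  obtain ⟨p, rfl⟩ := (adjointDomainEquiv n hκ hx).surjective g
  have hp : p.2 = 0 := (hB.boundary_values hκ hx p).1.symm.trans hg
  refine ⟨p.1, Eq.trans ?_ ((coe_adjointDomainEquiv hκ hx p).symm.trans hgf)⟩
  rw [hp, map_zero, add_zero]

theorem mem_opResolventSet (hB : IsPointTriplet B) (hκ : 0 < κ.re) (hx : Function.Injective x) :
    -κ ^ 2 ∈ opResolventSet B.A₀ := by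
  refine ⟨freeResolvent n hκ, hB.A₀_freeResolvent hκ hx, fun f => ?_⟩
  obtain ⟨φ, hφ⟩ := hB.mem_domain_A₀ hκ hx f
  obtain ⟨h, hA⟩ := hB.A₀_freeResolvent hκ hx φ
  obtain rfl : f = ⟨freeResolvent n hκ φ, h⟩ := Subtype.ext hφ.symm
  exact congrArg _ hA

theorem gammaDom_eq (hB : IsPointTriplet B) (hκ : 0 < κ.re) (hx : Function.Injective x)
    (hz : -κ ^ 2 ∈ opResolventSet B.A₀) (c : BoundarySpace m n) :
    B.gammaDom (-κ ^ 2) hz c = adjointDomainEquiv n hκ hx (0, c) := by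
  have hdefect : adjointDomainEquiv n hκ hx (0, c) ∈
      defectSubspace (minimalOperator n x) (-κ ^ 2) := by
    change (minimalOperator n x).adjoint _ - (-κ ^ 2) • _ = _
    rw [adjoint_adjointDomainEquiv, zero_sub, neg_smul]
    exact sub_self _
  have hsymm : (LinearEquiv.ofBijective _ (B.bijective_defect hz)).symm c = ⟨_, hdefect⟩ :=
    (LinearEquiv.symm_apply_eq _).mpr (hB.boundary_values hκ hx (0, c)).1.symm
  exact congrArg Subtype.val hsymm

theorem gammaField_eq_source (hB : IsPointTriplet B) (hκ : 0 < κ.re) (hx : Function.Injective x)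
    (hz : -κ ^ 2 ∈ opResolventSet B.A₀) (c : BoundarySpace m n) :
    B.gammaField (-κ ^ 2) hz c = source n hκ x c := by
  change (B.gammaDom (-κ ^ 2) hz c : L2 n) = _
  rw [hB.gammaDom_eq hκ hx, coe_adjointDomainEquiv, map_zero, zero_add]

theorem weyl_eq_ampliation (hB : IsPointTriplet B) (hκ : 0 < κ.re) (hx : Function.Injective x)
    (hz : -κ ^ 2 ∈ opResolventSet B.A₀) (c : BoundarySpace m n) :
    B.weyl (-κ ^ 2) hz c = ampliation (greenMatrix κ x) c := by
  change B.Γ₁ (B.gammaDom (-κ ^ 2) hz c) = _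
  rw [hB.gammaDom_eq hκ hx, (hB.boundary_values hκ hx _).2, map_zero, zero_add]

end IsPointTriplet

end Triplet

/-! ### The spectral parameter -/

section SpectralParameter

variable {n m : ℕ} {w : ℂ}

theorem sqrtC_sq (z : ℂ) : sqrtC z ^ 2 = z := by
  rw [sqrtC, one_div]
  exact Complex.cpow_ofNat_inv_pow z 2

theorem im_sqrtC_pos {z : ℂ} (hz : 0 < z.im) : 0 < (sqrtC z).im := by
  have hz₀ : z ≠ 0 := fun h => by simp [h] at hz
  have harg : 0 < z.arg := (Complex.arg_nonneg_iff.mpr hz.le).lt_of_ne' fun h =>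
    hz.ne' (Complex.arg_eq_zero_iff.mp h).2
  have him : (Complex.log z * (1 / 2)).im = z.arg / 2 := by
    rw [mul_one_div, Complex.div_ofNat_im, Complex.log_im]
  rw [sqrtC, Complex.cpow_def_of_ne_zero hz₀, Complex.exp_im, him]
  exact mul_pos (Real.exp_pos _)
    (Real.sin_pos_of_pos_of_lt_pi (half_pos harg) (by linarith [Complex.arg_le_pi z]))

theorem re_neg_I_mul_pos (hw : 0 < w.im) : 0 < (-Complex.I * w).re := by
  simpa using hw

theorem neg_sq_neg_I_mul (w : ℂ) : -(-Complex.I * w) ^ 2 = w ^ 2 := by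
  rw [mul_pow, neg_sq, Complex.I_sq, neg_one_mul, neg_neg]

theorem green_eq_hankel (hw : 0 < w.im) {y : Plane} (hy : y ≠ 0) :
    green (-Complex.I * w) y = Complex.I / 4 * hankel (w * ‖y‖) := by
  have him : 0 < (w * ‖y‖).im := by
    rw [Complex.im_mul_ofReal]
    exact mul_pos hw (norm_pos_iff.mpr hy)
  rw [hankel_eq_macdonald him, green, mul_assoc]

theorem greenConst_eq_digamma (w : ℂ) :
    greenConst (-Complex.I * w) =
      1 / (2 * Real.pi) * (Complex.digamma 1 - Complex.log (w / (2 * Complex.I))) := by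
  have hdiv : -Complex.I * w / 2 = w / (2 * Complex.I) := by
    rw [div_eq_div_iff two_ne_zero (by simp)]
    linear_combination (-2 * w) * Complex.I_sq
  rw [greenConst, Complex.digamma_one, hdiv]
  ring

/-- The matrix `M_s(z)` as a function of `w = √z`. -/
def hankelMatrix (x : Fin m → Plane) (w : ℂ) : Matrix (Fin m) (Fin m) ℂ :=
  Matrix.of fun j k =>
    1 / (2 * Real.pi) * (Complex.digamma 1 - Complex.log (w / (2 * Complex.I))) *
        (if j = k then 1 else 0) +
      if x j - x k = 0 then 0 else Complex.I / 4 * hankel (w * (‖x j - x k‖ : ℂ))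

theorem greenMatrix_eq_hankelMatrix {x : Fin m → Plane} (hx : Function.Injective x)
    (hw : 0 < w.im) : greenMatrix (-Complex.I * w) x = hankelMatrix x w := by
  ext j k
  rw [greenMatrix, hankelMatrix, Matrix.of_apply, Matrix.of_apply]
  rcases eq_or_ne j k with rfl | hjk
  · rw [if_pos rfl, if_pos rfl, if_pos (sub_self _), mul_one, add_zero, greenConst_eq_digamma]
  · have hne : x j - x k ≠ 0 := sub_ne_zero.mpr (hx.ne hjk)
    rw [if_neg hjk, if_neg hjk, if_neg hne, mul_zero, zero_add, green_eq_hankel hw hne]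

theorem ampliation_apply_apply (A : Matrix (Fin m) (Fin m) ℂ) (c : BoundarySpace m n) (j : Fin m)
    (s : Fin n) : ampliation A c j s = A.mulVec (fun k => c k s) j := by
  simp [ampliation, Matrix.mulVec, dotProduct]

theorem source_ae_eq_hankel (hw : 0 < w.im) (x : Fin m → Plane) (c : BoundarySpace m n) :
    source n (re_neg_I_mul_pos hw) x c =ᵐ[volume]
      fun y => ∑ j, (Complex.I / 4 * hankel (w * (‖y - x j‖ : ℂ))) • c j := by
  filter_upwards [source_ae_eq (re_neg_I_mul_pos hw) x c,
    ae_all_iff.mpr fun j => compl_mem_ae_iff.mpr (measure_singleton (x j))] with y hy hne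
  rw [hy]
  exact Finset.sum_congr rfl fun j _ => by rw [green_eq_hankel hw (sub_ne_zero.mpr (hne j))]

end SpectralParameter

end PointInteraction

end

theorem proposition5p2_general (n m : ℕ) (x : Fin m → Plane) (hx : Function.Injective x) :
    IsClosedSymmetric (minimalOperator n x) ∧
    (∃ B : BoundaryTriplet (minimalOperator n x) (BoundarySpace m n), IsPointTriplet B) ∧
    ∀ B : BoundaryTriplet (minimalOperator n x) (BoundarySpace m n), IsPointTriplet B →
      ∀ z w : ℂ, w ^ 2 = z → 0 < w.im → ∃ hz : z ∈ opResolventSet B.A₀,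
        (∀ (ξ : BoundarySpace m n) (j : Fin m) (s : Fin n),
          B.weyl z hz ξ j s = (hankelMatrix x w).mulVec (fun k => ξ k s) j) ∧
        ∀ ξ : BoundarySpace m n,
          (B.gammaField z hz ξ : Plane → EuclideanSpace ℂ (Fin n)) =ᵐ[volume]
            fun y => ∑ j, (Complex.I / 4 * hankel (w * (‖y - x j‖ : ℂ))) • ξ j := by
  refine ⟨isClosedSymmetric_minimalOperator hx, ⟨_, isPointTriplet_pointTriplet hx⟩, ?_⟩
  rintro B hB _ w rfl hw
  rw [← neg_sq_neg_I_mul]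
  have hκ := re_neg_I_mul_pos hw
  have hz := hB.mem_opResolventSet hκ hx
  refine ⟨hz, fun ξ j s => ?_, fun ξ => ?_⟩
  · rw [hB.weyl_eq_ampliation hκ hx hz, greenMatrix_eq_hankelMatrix hx hw, ampliation_apply_apply]
  · rw [hB.gammaField_eq_source hκ hx hz]
    exact source_ae_eq_hankel hw x ξ

theorem proposition5p2 (n m : ℕ) (x : Fin m → Plane) (hx : Function.Injective x) :
    IsClosedSymmetric (minimalOperator n x) ∧
    (∃ B : BoundaryTriplet (minimalOperator n x) (BoundarySpace m n), IsPointTriplet B) ∧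
    ∀ B : BoundaryTriplet (minimalOperator n x) (BoundarySpace m n), IsPointTriplet B →
      ∀ z : ℂ, 0 < z.im → ∃ hz : z ∈ opResolventSet B.A₀,
        (∀ (ξ : BoundarySpace m n) (j : Fin m) (s : Fin n),
          B.weyl z hz ξ j s = (weylMatrix x z).mulVec (fun k => ξ k s) j) ∧
        ∀ ξ : BoundarySpace m n,
          (B.gammaField z hz ξ : Plane → EuclideanSpace ℂ (Fin n)) =ᵐ[volume]
            fun y => ∑ j, (Complex.I / 4 * hankel (sqrtC z * (‖y - x j‖ : ℂ))) • ξ j := by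
  obtain ⟨hsymm, hex, h⟩ := proposition5p2_general n m x hx
  exact ⟨hsymm, hex, fun B hB z hz => h B hB z (sqrtC z) (sqrtC_sq z) (im_sqrtC_pos hz)⟩
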